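/- Let $\gamma=(\gamma_1,\gamma_2,\gamma_3)\in\mathbb C^3$ with $\operatorname{Im}\gamma_i<\tfrac12$ for $i=1,2,3$, and let $x=(x_1,x_2,x_3)\in\mathbb R^3$. Then the Givental integral for the $\mathfrak{gl}_3(\mathbb R)$-Whittaker function, $$ \Psi^{\mathrm{Giv}}_{\gamma}(x)=e^{\imath\gamma_3(x_1+x_2+x_3)}\int_{\mathbb R^3}dT_{11}\,dT_{21}\,dT_{22}\; e^{\imath(\gamma_2-\gamma_3)(T_{21}+T_{22})+\imath(\gamma_1-\gamma_2)T_{11}} $$ $$ \times\exp\Big\{-e^{x_1-T_{21}}-e^{T_{21}-x_2}-e^{x_2-T_{22}}-e^{T_{22}-x_3}-e^{T_{21}-T_{11}}-e^{T_{11}-T_{22}}\Big\}, $$ and the Mellin–Barnes integral, $$ \Psi^{\mathrm{MB}}_{\gamma}(x)=\frac{e^{\imath(\gamma_1+\gamma_2+\gamma_3)x_3-(x_1-x_3)}}{2!\,(2\pi)^3} \int_{\mathbb R^3}\frac{d\tau_{11}\,d\tau_{21}\,d\tau_{22}}{\Gamma(\imath\tau_{21}-\imath\tau_{22})\,\Gamma(\imath\tau_{22}-\imath\tau_{21})}\;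 e^{\imath(x_2-x_3)(\tau_{21}+\tau_{22})+\imath(x_1-x_2)\tau_{11}} $$ $$ \times\;\Gamma\Big(\imath(\tau_{21}-\tau_{11})+\tfrac12\Big)\,\Gamma\Big(\imath(\tau_{22}-\tau_{11})+\tfrac12\Big) \prod_{i=1}^3\prod_{j=1}^2\Gamma\Big(\imath(\gamma_i-\tau_{2j})+\tfrac12\Big), $$ both converge absolutely and coincide: $\Psi^{\mathrm{Giv}}_{\gamma}(x)=\Psi^{\mathrm{MB}}_{\gamma}(x)$. (The function $1/\Gamma$ is understood as an entire function, so the Mellin–Barnes integrand vanishes where $\tau_{21}=\tau_{22}$.) -/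

import Mathlib

noncomputable section

/-- The integrand of the Givental integral for the `gl₃(ℝ)`-Whittaker function, without the factor
in front of the integral. The spectral parameters are `γ₁, γ₂, γ₃ = γ 0, γ 1, γ 2`, the
coordinates are `x₁, x₂, x₃ = x 0, x 1, x 2`, and the integration variable is
`T = (T₁₁, T₂₁, T₂₂)`. -/
def giventalIntegrand (γ : Fin 3 → ℂ) (x : Fin 3 → ℝ) : ℝ × ℝ × ℝ → ℂ :=
  fun (T₁₁, T₂₁, T₂₂) =>
    Complex.exp (Complex.I * (γ 1 - γ 2) * ((T₂₁ : ℂ) + (T₂₂ : ℂ))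
        + Complex.I * (γ 0 - γ 1) * (T₁₁ : ℂ))
      * (Real.exp (-Real.exp (x 0 - T₂₁) - Real.exp (T₂₁ - x 1)
          - Real.exp (x 1 - T₂₂) - Real.exp (T₂₂ - x 2)
          - Real.exp (T₂₁ - T₁₁) - Real.exp (T₁₁ - T₂₂)) : ℂ)

/-- The Givental integral over `ℝ³` for the `gl₃(ℝ)`-Whittaker function. -/
def giventalIntegral (γ : Fin 3 → ℂ) (x : Fin 3 → ℝ) : ℂ :=
  Complex.exp (Complex.I * γ 2 * ((x 0 : ℂ) + (x 1 : ℂ) + (x 2 : ℂ)))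
    * ∫ T : ℝ × ℝ × ℝ, giventalIntegrand γ x T

/-- The integrand of the Mellin–Barnes integral for the `gl₃(ℝ)`-Whittaker function, without the
factor in front of the integral. The integration variable is `τ = (τ₁₁, τ₂₁, τ₂₂)`. Where
`τ₂₁ = τ₂₂`, both Gamma functions in the denominator have a pole, and the integrand is `0`:
this is the value that the convention `1 / 0 = 0` gives, since `Complex.Gamma 0 = 0`. -/
def mellinBarnesIntegrand (γ : Fin 3 → ℂ) (x : Fin 3 → ℝ) : ℝ × ℝ × ℝ → ℂ :=
  fun (τ₁₁, τ₂₁, τ₂₂) =>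
    1 / (Complex.Gamma (Complex.I * τ₂₁ - Complex.I * τ₂₂)
          * Complex.Gamma (Complex.I * τ₂₂ - Complex.I * τ₂₁))
      * Complex.exp (Complex.I * ((x 1 : ℂ) - (x 2 : ℂ)) * ((τ₂₁ : ℂ) + (τ₂₂ : ℂ))
          + Complex.I * ((x 0 : ℂ) - (x 1 : ℂ)) * (τ₁₁ : ℂ))
      * Complex.Gamma (Complex.I * ((τ₂₁ : ℂ) - (τ₁₁ : ℂ)) + 1 / 2)
      * Complex.Gamma (Complex.I * ((τ₂₂ : ℂ) - (τ₁₁ : ℂ)) + 1 / 2)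
      * ∏ i : Fin 3, (Complex.Gamma (Complex.I * (γ i - (τ₂₁ : ℂ)) + 1 / 2)
          * Complex.Gamma (Complex.I * (γ i - (τ₂₂ : ℂ)) + 1 / 2))

/-- The Mellin–Barnes integral over `ℝ³` for the `gl₃(ℝ)`-Whittaker function, with
`ρ(x) = x₁ - x₃`. The factor `2` next to `(2π)³` is the order `2!` of the symmetric group
that permutes `τ₂₁` and `τ₂₂`. -/
def mellinBarnesIntegral (γ : Fin 3 → ℂ) (x : Fin 3 → ℝ) : ℂ :=
  Complex.exp (Complex.I * (γ 0 + γ 1 + γ 2) * (x 2 : ℂ) - ((x 0 : ℂ) - (x 2 : ℂ)))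
      / (2 * (2 * (Real.pi : ℂ)) ^ 3)
    * ∫ τ : ℝ × ℝ × ℝ, mellinBarnesIntegrand γ x τ

end

/-!
Both integrals are equal to Bump's double Mellin–Barnes integral, whose kernel is
`∏ᵢ Γ(s₁ + iγᵢ) Γ(s₂ + i(γ₁ + γ₂ + γ₃ - γᵢ)) / Γ(s₁ + s₂ + i(γ₁ + γ₂ + γ₃))`.

On the Givental side, Mellin inversion replaces the two factors that contain `x₁` and `x₃` by
integrals of Gamma functions over vertical lines; after an exchange of integrals, what remains is
an elementary integral over `ℝ³` that splits into Gamma and Beta integrals.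

On the Mellin–Barnes side, the integral over `τ₂₁ - τ₂₂` with `τ₂₁ + τ₂₂` fixed is the
de Branges–Wilson integral. That integral satisfies, by a contour shift, a contiguity relation
which determines how it changes under `a ↦ a + 1`; letting `a → ∞` reduces it to a function of
three parameters, and the symmetry in the parameters forces this function to be the expected
product of Gamma functions up to a constant, which is read off at `(1/2, 1/2, 1/2)`.
-/

open MeasureTheory Set Filter Topology Asymptotics
open Complex (I Gamma)
open scoped Real Complex

/-! ### Integration on the real line -/

theorem integrable_exp_neg_mul_abs {c : ℝ} (hc : 0 < c) :
    Integrable fun x : ℝ => rexp (-c * |x|) := by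
  refine .of_integral_ne_zero ?_
  rw [integral_comp_abs (f := fun x => rexp (-c * x)), integral_exp_mul_Ioi (neg_neg_of_pos hc)]
  simp [hc.ne']

theorem integral_Ioi_eq_integral_exp_smul {E : Type*} [NormedAddCommGroup E] [NormedSpace ℝ E]
    (f : ℝ → E) : ∫ x in Ioi (0 : ℝ), f x = ∫ t : ℝ, rexp t • f (rexp t) := by
  rw [← Real.range_exp, ← image_univ, integral_image_eq_integral_abs_deriv_smul .univ
    (fun t _ => (Real.hasDerivAt_exp t).hasDerivWithinAt) Real.exp_injective.injOn,
    setIntegral_univ]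
  simp only [Real.abs_exp]

section HorizontalContour

variable {f : ℂ → ℂ} {g : ℝ → ℝ} {a b : ℝ}

theorem continuous_comp_add_mul_I (hf : ContinuousOn f {u | u.im ∈ uIcc a b}) {y : ℝ}
    (hy : y ∈ uIcc a b) : Continuous fun t : ℝ => f (t + y * I) :=
  hf.comp_continuous (by fun_prop) fun t => by simpa using hy

theorem integrable_comp_add_mul_I (hf : ContinuousOn f {u | u.im ∈ uIcc a b})
    (hfg : f =O[𝓟 {u | u.im ∈ uIcc a b}] fun u => g u.re) (hg : Integrable g) {y : ℝ}
    (hy : y ∈ uIcc a b) : Integrable fun t : ℝ => f (t + y * I) := by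
  have hline : Tendsto (fun t : ℝ => (t + y * I : ℂ)) ⊤ (𝓟 {u | u.im ∈ uIcc a b}) :=
    tendsto_principal.2 (eventually_top.2 fun t => by simpa using hy)
  refine IsBigO.integrable (continuous_comp_add_mul_I hf hy).aestronglyMeasurable ?_ hg
  simpa [Function.comp_def] using hfg.comp_tendsto hline

theorem intervalIntegral_horizontal_sub_isBigO (hf : DifferentiableOn ℂ f {u | u.im ∈ uIcc a b})
    (hfg : f =O[𝓟 {u | u.im ∈ uIcc a b}] fun u => g u.re) :
    (fun R : ℝ => ∫ t in (-R)..R, (f (t + a * I) - f (t + b * I)))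
      =O[⊤] fun R => |g (-R)| + |g R| := by
  obtain ⟨C, hC⟩ := hfg.bound
  have hside (x : ℝ) : ‖∫ y in a..b, f (x + y * I)‖ ≤ C * |g x| * |b - a| :=
    intervalIntegral.norm_integral_le_of_norm_le_const fun y hy => by
      simpa using eventually_principal.1 hC (x + y * I) (by simpa using uIoc_subset_uIcc hy)
  refine .of_bound (C * |b - a|) (eventually_top.2 fun R => ?_)
  have hint {y : ℝ} (hy : y ∈ uIcc a b) :
      IntervalIntegrable (fun t : ℝ => f (t + y * I)) volume (-R) R :=
    (continuous_comp_add_mul_I hf.continuousOn hy).intervalIntegrable _ _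
  have hrect := Complex.integral_boundary_rect_eq_zero_of_differentiableOn f (-R + a * I)
    (R + b * I) (hf.mono fun u hu => by simpa using hu.2)
  simp only [Complex.add_re, Complex.add_im, Complex.neg_re, Complex.neg_im, Complex.ofReal_re,
    Complex.ofReal_im, Complex.re_ofReal_mul, Complex.im_ofReal_mul, Complex.I_re, Complex.I_im,
    mul_zero, mul_one, add_zero, neg_zero, zero_add] at hrect
  rw [← intervalIntegral.integral_sub (hint left_mem_uIcc) (hint right_mem_uIcc)] at hrect
  have hsides : ∫ t in (-R)..R, (f (t + a * I) - f (t + b * I))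
      = I * ((∫ y in a..b, f ((-R : ℝ) + y * I)) - ∫ y in a..b, f (R + y * I)) := by
    simp only [smul_eq_mul] at hrect
    linear_combination hrect
  rw [hsides, norm_mul, Complex.norm_I, one_mul, Real.norm_of_nonneg (by positivity)]
  linarith [norm_sub_le (∫ y in a..b, f ((-R : ℝ) + y * I)) (∫ y in a..b, f (R + y * I)),
    hside (-R), hside R]

-- The difference of the two integrals truncated at `±R` is an integrable function of `R`, by the
-- bound on the vertical sides, so the only limit it can have is `0`.
theorem integral_horizontal_eq (hf : DifferentiableOn ℂ f {u | u.im ∈ uIcc a b})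
    (hfg : f =O[𝓟 {u | u.im ∈ uIcc a b}] fun u => g u.re) (hg : Integrable g) :
    ∫ t : ℝ, f (t + a * I) = ∫ t : ℝ, f (t + b * I) := by
  have ha := integrable_comp_add_mul_I hf.continuousOn hfg hg left_mem_uIcc
  have hb := integrable_comp_add_mul_I hf.continuousOn hfg hg right_mem_uIcc
  have hint := ha.sub hb
  have hcont : Continuous fun R : ℝ => ∫ t in (-R)..R, (f (t + a * I) - f (t + b * I)) := by
    have hprim := intervalIntegral.continuous_primitive (fun _ _ => hint.intervalIntegrable) 0
    convert! hprim.sub (hprim.comp continuous_neg) using 2 with R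
    exact (intervalIntegral.integral_interval_sub_left hint.intervalIntegrable
      hint.intervalIntegrable).symm
  have hIntegrable : Integrable fun R : ℝ => ∫ t in (-R)..R, (f (t + a * I) - f (t + b * I)) :=
    (intervalIntegral_horizontal_sub_isBigO hf hfg).integrable hcont.aestronglyMeasurable
      (hg.comp_neg.abs.add hg.abs)
  have hlim := intervalIntegral_tendsto_integral hint tendsto_neg_atTop_atBot tendsto_id
  rw [← sub_eq_zero, ← integral_sub ha hb]
  refine (hIntegrable.integrableAtFilter atTop).eq_zero_of_tendsto (fun s hs => ?_) hlim
  obtain ⟨R, hR⟩ := mem_atTop_sets.1 hs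
  exact measure_mono_top hR Real.volume_Ici

end HorizontalContour

/-! ### The Gamma function on vertical strips -/

theorem add_re_pos {z w : ℂ} (hz : 0 < z.re) (hw : 0 < w.re) : 0 < (z + w).re :=
  add_pos hz hw

theorem add_natCast_re_pos {z : ℂ} (hz : 0 < z.re) (n : ℕ) : 0 < (z + n).re :=
  add_pos_of_pos_of_nonneg hz n.cast_nonneg

theorem ofReal_exp_cpow (t : ℝ) (z : ℂ) : (rexp t : ℂ) ^ z = cexp (t * z) := by
  rw [Complex.cpow_def_of_ne_zero (by simp), ← Complex.ofReal_log t.exp_pos.le, Real.log_exp]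

theorem integral_exp_mul_sub_exp {z : ℂ} (hz : 0 < z.re) :
    ∫ t : ℝ, cexp (z * t - cexp t) = Gamma z := by
  rw [Complex.Gamma_eq_integral hz, Complex.GammaIntegral, integral_Ioi_eq_integral_exp_smul]
  congr! 2 with t
  rw [ofReal_exp_cpow, Complex.real_smul]
  push_cast
  rw [← Complex.exp_add, ← Complex.exp_add]
  ring_nf

theorem integral_rexp_mul_sub_mul_rexp {a r : ℝ} (ha : 0 < a) (hr : 0 < r) :
    ∫ t : ℝ, rexp (a * t - r * rexp t) = (1 / r) ^ a * Real.Gamma a := by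
  rw [← Real.integral_rpow_mul_exp_neg_mul_Ioi ha hr, integral_Ioi_eq_integral_exp_smul]
  congr! 2 with t
  rw [← Real.exp_mul, smul_eq_mul, ← Real.exp_add, ← Real.exp_add]
  ring_nf

theorem integrable_rexp_mul_sub_mul_rexp {a r : ℝ} (ha : 0 < a) (hr : 0 < r) :
    Integrable fun t : ℝ => rexp (a * t - r * rexp t) := by
  refine .of_integral_ne_zero ?_
  rw [integral_rexp_mul_sub_mul_rexp ha hr]
  exact (mul_pos (by positivity) (Real.Gamma_pos_of_pos ha)).ne'

theorem norm_exp_mul_sub_exp (z u : ℂ) :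
    ‖cexp (z * u - cexp u)‖
      = rexp (-z.im * u.im) * rexp (z.re * u.re - Real.cos u.im * rexp u.re) := by
  rw [Complex.norm_exp, Complex.sub_re, Complex.mul_re, Complex.exp_re, ← Real.exp_add]
  ring_nf

theorem integrable_exp_mul_sub_exp {z : ℂ} (hz : 0 < z.re) :
    Integrable fun t : ℝ => cexp (z * t - cexp t) := by
  refine (integrable_rexp_mul_sub_mul_rexp hz one_pos).congr' (by fun_prop)
    (ae_of_all _ fun t => ?_)
  simp [norm_exp_mul_sub_exp]

theorem integral_exp_mul_sub_exp_add_mul_I {z : ℂ} (hz : 0 < z.re) {θ : ℝ} (hθ : |θ| < π / 2) :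
    ∫ t : ℝ, cexp (z * (t + θ * I) - cexp (t + θ * I)) = Gamma z := by
  have hcos : 0 < Real.cos θ := Real.cos_pos_of_mem_Ioo (abs_lt.1 hθ)
  have hbound : (fun u => cexp (z * u - cexp u)) =O[𝓟 {u | u.im ∈ uIcc 0 θ}]
      fun u => rexp (z.re * u.re - Real.cos θ * rexp u.re) := by
    refine .of_bound (rexp (|z.im| * |θ|)) (eventually_principal.2 fun u hu => ?_)
    have him : |u.im| ≤ |θ| := by simpa using abs_sub_left_of_mem_uIcc hu
    have hcos_le : Real.cos θ ≤ Real.cos u.im := by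
      rw [← Real.cos_abs θ, ← Real.cos_abs u.im]
      exact Real.cos_le_cos_of_nonneg_of_le_pi (abs_nonneg _) (by linarith [Real.pi_pos]) him
    have hmul : -z.im * u.im ≤ |z.im| * |θ| :=
      calc -z.im * u.im ≤ |-z.im| * |u.im| := (le_abs_self _).trans_eq (abs_mul _ _)
        _ ≤ |z.im| * |θ| := by rw [abs_neg]; gcongr
    rw [norm_exp_mul_sub_exp, Real.norm_of_nonneg (Real.exp_pos _).le]
    exact mul_le_mul (Real.exp_le_exp.2 hmul) (by gcongr) (Real.exp_pos _).le (Real.exp_pos _).le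
  have hshift := integral_horizontal_eq (by fun_prop) hbound
    (integrable_rexp_mul_sub_mul_rexp hz hcos)
  rw [← hshift, ← integral_exp_mul_sub_exp hz]
  simp

theorem norm_Gamma_le_exp_mul {s : ℂ} (hs : 0 < s.re) {θ : ℝ} (hθ : |θ| < π / 2) :
    ‖Gamma s‖ ≤ rexp (-θ * s.im) * ((1 / Real.cos θ) ^ s.re * Real.Gamma s.re) := by
  have hcos : 0 < Real.cos θ := Real.cos_pos_of_mem_Ioo (abs_lt.1 hθ)
  rw [← integral_exp_mul_sub_exp_add_mul_I hs hθ, ← integral_rexp_mul_sub_mul_rexp hs hcos,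
    ← integral_const_mul]
  refine (norm_integral_le_integral_norm _).trans_eq ?_
  simp [norm_exp_mul_sub_exp, mul_comm]

theorem norm_Gamma_le_Gamma_re {s : ℂ} (hs : 0 < s.re) : ‖Gamma s‖ ≤ Real.Gamma s.re := by
  simpa using norm_Gamma_le_exp_mul hs (θ := 0) (by simpa using Real.pi_div_two_pos)

theorem norm_Gamma_le_exp_abs_mul {s : ℂ} (hs : 0 < s.re) {θ : ℝ} (hθ : |θ| < π / 2) :
    ‖Gamma s‖ ≤ rexp (-θ * |s.im|) * ((1 / Real.cos θ) ^ s.re * Real.Gamma s.re) := by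
  rcases abs_choice s.im with h | h
  · simpa only [h] using norm_Gamma_le_exp_mul hs hθ
  · simpa only [h, Real.cos_neg, neg_mul_neg, neg_mul, mul_neg] using
      norm_Gamma_le_exp_mul hs ((abs_neg θ).trans_lt hθ)

theorem Gamma_isBigO_exp_abs_im {a b θ : ℝ} (ha : 0 < a) (hθ : |θ| < π / 2) :
    Gamma =O[𝓟 {s | s.re ∈ Icc a b}] fun s => rexp (-θ * |s.im|) := by
  have hcos : 0 < Real.cos θ := Real.cos_pos_of_mem_Ioo (abs_lt.1 hθ)
  have hcont : ContinuousOn (fun r : ℝ => (1 / Real.cos θ) ^ r * Real.Gamma r) (Icc a b) :=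
    (continuous_const.rpow continuous_id fun _ => .inl (by positivity)).continuousOn.mul
      (Real.differentiableOn_Gamma_Ioi.continuousOn.mono fun r hr => ha.trans_le hr.1)
  obtain ⟨C, hC⟩ := isCompact_Icc.exists_bound_of_continuousOn hcont
  refine .of_bound C (eventually_principal.2 fun s hs => ?_)
  calc ‖Gamma s‖ ≤ rexp (-θ * |s.im|) * ((1 / Real.cos θ) ^ s.re * Real.Gamma s.re) :=
        norm_Gamma_le_exp_abs_mul (ha.trans_le hs.1) hθ
    _ ≤ rexp (-θ * |s.im|) * C := by
        gcongr
        exact (le_abs_self _).trans (hC _ hs)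
    _ = C * ‖rexp (-θ * |s.im|)‖ := by rw [Real.norm_of_nonneg (Real.exp_pos _).le, mul_comm]

theorem differentiableAt_Gamma_of_re_pos {s : ℂ} (hs : 0 < s.re) : DifferentiableAt ℂ Gamma s :=
  Complex.differentiableAt_Gamma s fun m h => by
    rw [h, Complex.neg_re, Complex.natCast_re] at hs
    linarith [m.cast_nonneg (α := ℝ)]

theorem continuous_Gamma_comp {X : Type*} [TopologicalSpace X] {f : X → ℂ} (hf : Continuous f)
    (hre : ∀ x, 0 < (f x).re) : Continuous fun x => Gamma (f x) :=
  continuous_iff_continuousAt.2 fun x =>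
    (differentiableAt_Gamma_of_re_pos (hre x)).continuousAt.comp hf.continuousAt

theorem Gamma_comp_isBigO_exp {X : Type*} {l : Filter X} {f : X → ℂ} {h : X → ℝ} {a b C θ : ℝ}
    (ha : 0 < a) (hθ₀ : 0 ≤ θ) (hθ : θ < π / 2) (hre : ∀ᶠ x in l, (f x).re ∈ Icc a b)
    (him : ∀ x, h x - C ≤ |(f x).im|) :
    (fun x => Gamma (f x)) =O[l] fun x => rexp (-θ * h x) := by
  refine ((Gamma_isBigO_exp_abs_im ha (by rwa [abs_of_nonneg hθ₀])).comp_tendsto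
    (tendsto_principal.2 hre)).trans (.of_bound (rexp (θ * C)) (.of_forall fun x => ?_))
  simp only [Function.comp_apply, Real.norm_eq_abs, Real.abs_exp, ← Real.exp_add]
  gcongr
  nlinarith [him x]

/-! ### The de Branges–Wilson integral -/

/-- The product `Γ(a + iu) Γ(a - iu)` out of which the weights of the de Branges–Wilson integral
are built. -/
noncomputable def gammaPair (a u : ℂ) : ℂ := Gamma (a + I * u) * Gamma (a - I * u)

/-- The factor `1 / (Γ(2iu) Γ(-2iu))` of the weights of the de Branges–Wilson integral, in closed
form. -/
noncomputable def wilsonDensity (u : ℂ) : ℂ := 2 * u * Complex.sinh (2 * π * u) / π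

/-- The weight of the continuous dual Hahn polynomials. -/
noncomputable def continuousDualHahnWeight (b c d : ℂ) (t : ℝ) : ℂ :=
  wilsonDensity t * (gammaPair b t * gammaPair c t * gammaPair d t)

/-- The de Branges–Wilson integral, which is the total mass of the weight of the Wilson
polynomials. -/
noncomputable def wilsonIntegral (a b c d : ℂ) : ℂ :=
  ∫ t : ℝ, gammaPair a t * continuousDualHahnWeight b c d t

theorem one_div_Gamma_mul_Gamma_neg (u : ℂ) :
    1 / (Gamma (2 * I * u) * Gamma (-(2 * I * u))) = wilsonDensity u := by
  rcases eq_or_ne u 0 with rfl | hu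
  · simp [wilsonDensity]
  have hne : -(2 * I * u) ≠ 0 := by simp [hu]
  have hrefl := Complex.Gamma_mul_Gamma_one_sub (2 * I * u)
  have hsin : Complex.sin (π * (2 * I * u)) = Complex.sinh (2 * π * u) * I := by
    rw [← Complex.sin_mul_I]
    ring_nf
  rw [sub_eq_neg_add, Complex.Gamma_add_one _ hne, hsin] at hrefl
  have hprod : Gamma (2 * I * u) * Gamma (-(2 * I * u)) = (wilsonDensity u)⁻¹ := by
    refine mul_left_cancel₀ hne ?_
    rw [mul_left_comm, hrefl, wilsonDensity]
    field_simp
    simp [neg_div]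
  rw [hprod, one_div, inv_inv]

theorem gammaPair_isBigO_exp {a : ℂ} {l : Filter ℂ} {r θ : ℝ} (hr : r < a.re) (hθ₀ : 0 ≤ θ)
    (hθ : θ < π / 2) (hl : ∀ᶠ u in l, |u.im| ≤ r) :
    gammaPair a =O[l] fun u => rexp (-(2 * θ) * |u.re|) := by
  have hmem {x : ℝ} (hx : |x| ≤ r) : a.re + x ∈ Icc (a.re - r) (a.re + r) := by
    constructor <;> linarith [abs_le.1 hx]
  have habs (y : ℝ) : |y| - |a.im| ≤ |a.im + y| := by
    simpa [add_comm] using abs_sub_abs_le_abs_sub y (-a.im)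
  have hadd : (fun u => Gamma (a + I * u)) =O[l] fun u => rexp (-θ * |u.re|) := by
    refine Gamma_comp_isBigO_exp (b := a.re + r) (C := |a.im|) (sub_pos.2 hr) hθ₀ hθ ?_
      fun u => ?_
    · filter_upwards [hl] with u hu
      simpa using hmem ((abs_neg _).trans_le hu)
    · simpa using habs u.re
  have hsub : (fun u => Gamma (a - I * u)) =O[l] fun u => rexp (-θ * |u.re|) := by
    refine Gamma_comp_isBigO_exp (b := a.re + r) (C := |a.im|) (sub_pos.2 hr) hθ₀ hθ ?_
      fun u => ?_
    · filter_upwards [hl] with u hu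
      simpa using hmem hu
    · simpa [sub_eq_add_neg] using habs (-u.re)
  refine (hadd.mul hsub).congr_right fun u => ?_
  rw [← Real.exp_add]
  ring_nf

theorem gammaPair_ofReal_isBigO_exp {a : ℂ} (ha : 0 < a.re) {θ : ℝ} (hθ₀ : 0 ≤ θ)
    (hθ : θ < π / 2) : (fun t : ℝ => gammaPair a t) =O[⊤] fun t => rexp (-(2 * θ) * |t|) := by
  simpa [Function.comp_def] using isBigO_map.1 <|
    gammaPair_isBigO_exp (l := map Complex.ofReal ⊤) ha hθ₀ hθ (by simp)

theorem differentiableAt_gammaPair {a u : ℂ} (hu : |u.im| < a.re) :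
    DifferentiableAt ℂ (gammaPair a) u := by
  have him := abs_lt.1 hu
  have hadd : 0 < (a + I * u).re := by simp; linarith
  have hsub : 0 < (a - I * u).re := by simp; linarith
  exact ((differentiableAt_Gamma_of_re_pos hadd).comp u (by fun_prop)).mul
    ((differentiableAt_Gamma_of_re_pos hsub).comp u (by fun_prop))

theorem continuous_gammaPair_ofReal {a : ℂ} (ha : 0 < a.re) :
    Continuous fun t : ℝ => gammaPair a t :=
  continuous_iff_continuousAt.2 fun t =>
    (differentiableAt_gammaPair (by simpa)).continuousAt.comp (by fun_prop)

theorem norm_sinh_le_exp_abs_re (z : ℂ) : ‖Complex.sinh z‖ ≤ rexp |z.re| := by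
  have hz : ‖cexp z‖ ≤ rexp |z.re| := by rw [Complex.norm_exp]; gcongr; exact le_abs_self _
  have hz' : ‖cexp (-z)‖ ≤ rexp |z.re| := by rw [Complex.norm_exp]; gcongr; exact neg_le_abs _
  rw [Complex.sinh, norm_div, Complex.norm_ofNat]
  linarith [norm_sub_le (cexp z) (cexp (-z))]

theorem wilsonDensity_ofReal_isBigO_exp {c : ℝ} (hc : 2 * π < c) :
    (fun t : ℝ => wilsonDensity t) =O[⊤] fun t => rexp (c * |t|) := by
  refine .of_bound (2 / π / (c - 2 * π)) (eventually_top.2 fun t => ?_)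
  have hlin : (c - 2 * π) * |t| ≤ rexp ((c - 2 * π) * |t|) := by
    linarith [Real.add_one_le_exp ((c - 2 * π) * |t|)]
  have hsplit : rexp (c * |t|) = rexp ((c - 2 * π) * |t|) * rexp (2 * π * |t|) := by
    rw [← Real.exp_add]
    ring_nf
  have hsinh : ‖Complex.sinh (2 * π * t)‖ ≤ rexp (2 * π * |t|) := by
    simpa [abs_mul, abs_of_pos Real.pi_pos] using norm_sinh_le_exp_abs_re (2 * π * t)
  calc ‖wilsonDensity t‖ = 2 / π * (|t| * ‖Complex.sinh (2 * π * t)‖) := by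
        simp only [wilsonDensity, norm_div, norm_mul, Complex.norm_ofNat, Complex.norm_real,
          Real.norm_eq_abs, abs_of_pos Real.pi_pos]
        ring
    _ ≤ 2 / π * (rexp ((c - 2 * π) * |t|) / (c - 2 * π) * rexp (2 * π * |t|)) := by
        gcongr
        rwa [le_div_iff₀' (sub_pos.2 hc)]
    _ = 2 / π / (c - 2 * π) * ‖rexp (c * |t|)‖ := by
        rw [hsplit, Real.norm_of_nonneg (by positivity)]
        ring

theorem continuousDualHahnWeight_isBigO_exp {b c d : ℂ} (hb : 0 < b.re) (hc : 0 < c.re)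
    (hd : 0 < d.re) : continuousDualHahnWeight b c d =O[⊤] fun t => rexp (-2 * |t|) := by
  have hpair {a : ℂ} (ha : 0 < a.re) := gammaPair_ofReal_isBigO_exp ha
    (θ := 3 / 2) (by norm_num) (by linarith [Real.pi_gt_three])
  have hdensity := wilsonDensity_ofReal_isBigO_exp (c := 7) (by linarith [Real.pi_lt_d2])
  refine (hdensity.mul (((hpair hb).mul (hpair hc)).mul (hpair hd))).congr_right fun t => ?_
  simp only [← Real.exp_add]
  ring_nf

theorem continuous_continuousDualHahnWeight {b c d : ℂ} (hb : 0 < b.re) (hc : 0 < c.re)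
    (hd : 0 < d.re) : Continuous (continuousDualHahnWeight b c d) := by
  have hdensity : Continuous fun t : ℝ => wilsonDensity t := by
    unfold wilsonDensity
    fun_prop
  exact hdensity.mul (((continuous_gammaPair_ofReal hb).mul (continuous_gammaPair_ofReal hc)).mul
    (continuous_gammaPair_ofReal hd))

theorem integrable_continuousDualHahnWeight {b c d : ℂ} (hb : 0 < b.re) (hc : 0 < c.re)
    (hd : 0 < d.re) : Integrable (continuousDualHahnWeight b c d) :=
  (continuousDualHahnWeight_isBigO_exp hb hc hd).integrable
    (continuous_continuousDualHahnWeight hb hc hd).aestronglyMeasurable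
    (integrable_exp_neg_mul_abs two_pos)

theorem integrable_gammaPair_mul_continuousDualHahnWeight {a b c d : ℂ} (ha : 0 < a.re)
    (hb : 0 < b.re) (hc : 0 < c.re) (hd : 0 < d.re) :
    Integrable fun t : ℝ => gammaPair a t * continuousDualHahnWeight b c d t := by
  have hpair : (fun t : ℝ => gammaPair a t) =O[⊤] fun _ => (1 : ℝ) := by
    simpa using gammaPair_ofReal_isBigO_exp ha le_rfl Real.pi_div_two_pos
  refine ((hpair.mul (isBigO_refl (continuousDualHahnWeight b c d) ⊤).norm_right).integrable
    ?_ ((integrable_continuousDualHahnWeight hb hc hd).norm.const_mul 1))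
  exact ((continuous_gammaPair_ofReal ha).mul
    (continuous_continuousDualHahnWeight hb hc hd)).aestronglyMeasurable

theorem gammaPair_add_one {a : ℂ} (ha : 0 < a.re) (t : ℝ) :
    gammaPair (a + 1) t = (a ^ 2 + t ^ 2) * gammaPair a t := by
  have hadd : a + I * t ≠ 0 := fun h => ha.ne' (by simpa using congr_arg Complex.re h)
  have hsub : a - I * t ≠ 0 := fun h => ha.ne' (by simpa using congr_arg Complex.re h)
  rw [gammaPair, add_right_comm, add_sub_right_comm, Complex.Gamma_add_one _ hadd,
    Complex.Gamma_add_one _ hsub, gammaPair]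
  linear_combination (-(t ^ 2 : ℂ) * Gamma (a + I * t) * Gamma (a - I * t)) * Complex.I_sq

theorem gammaPair_neg (a u : ℂ) : gammaPair a (-u) = gammaPair a u := by
  rw [gammaPair, gammaPair, mul_neg, sub_neg_eq_add, ← sub_eq_add_neg, mul_comm]

theorem gammaPair_add_half_mul_I {a : ℂ} (ha : 0 < a.re) (t : ℝ) :
    gammaPair (a + 1 / 2) (t + (1 / 2 : ℝ) * I) = (a - I * t) * gammaPair a t := by
  have hsub : a - I * t ≠ 0 := fun h => ha.ne' (by simpa using congr_arg Complex.re h)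
  have hadd_arg : a + 1 / 2 + I * (t + (1 / 2 : ℝ) * I) = a + I * t := by
    push_cast
    linear_combination (1 / 2 : ℂ) * Complex.I_sq
  have hsub_arg : a + 1 / 2 - I * (t + (1 / 2 : ℝ) * I) = a - I * t + 1 := by
    push_cast
    linear_combination (-1 / 2 : ℂ) * Complex.I_sq
  rw [gammaPair, hadd_arg, hsub_arg, Complex.Gamma_add_one _ hsub, gammaPair]
  ring

theorem wilsonIntegral_swap (a b c d : ℂ) : wilsonIntegral a b c d = wilsonIntegral d b c a := by
  simp only [wilsonIntegral, continuousDualHahnWeight]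
  congr! 2 with t
  ring

section Contiguity

variable {a b c d : ℂ}

/-- The function whose contour integrals along `im u = ± 1 / 2` give the contiguity relation of
the de Branges–Wilson integral. -/
noncomputable def shiftedWilsonIntegrand (a b c d u : ℂ) : ℂ :=
  Complex.sinh (2 * π * u) * (gammaPair (a + 1 / 2) u * gammaPair (b + 1 / 2) u
    * (gammaPair (c + 1 / 2) u * gammaPair (d + 1 / 2) u))

theorem differentiableOn_shiftedWilsonIntegrand (ha : 0 < a.re) (hb : 0 < b.re) (hc : 0 < c.re)
    (hd : 0 < d.re) :
    DifferentiableOn ℂ (shiftedWilsonIntegrand a b c d) {u | |u.im| ≤ 1 / 2} := by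
  intro u hu
  have hsinh : DifferentiableAt ℂ (fun u => Complex.sinh (2 * π * u)) u := by fun_prop
  have hpair {z : ℂ} (hz : 0 < z.re) : DifferentiableAt ℂ (gammaPair (z + 1 / 2)) u :=
    differentiableAt_gammaPair (lt_of_le_of_lt hu (by simpa))
  exact (hsinh.mul
    (((hpair ha).mul (hpair hb)).mul ((hpair hc).mul (hpair hd)))).differentiableWithinAt

theorem shiftedWilsonIntegrand_isBigO_exp (ha : 0 < a.re) (hb : 0 < b.re) (hc : 0 < c.re)
    (hd : 0 < d.re) :
    shiftedWilsonIntegrand a b c d =O[𝓟 {u | |u.im| ≤ 1 / 2}]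
      fun u => rexp (-(12 - 2 * π) * |u.re|) := by
  have hpair {z : ℂ} (hz : 0 < z.re) := gammaPair_isBigO_exp (a := z + 1 / 2) (r := 1 / 2)
    (θ := 3 / 2) (by simpa) (by norm_num) (by linarith [Real.pi_gt_three])
    (mem_principal_self {u : ℂ | |u.im| ≤ 1 / 2})
  have hsinh : (fun u : ℂ => Complex.sinh (2 * π * u))
      =O[𝓟 {u | |u.im| ≤ 1 / 2}] fun u => rexp (2 * π * |u.re|) :=
    .of_norm_le fun u => by
      simpa [abs_mul, abs_of_pos Real.pi_pos] using norm_sinh_le_exp_abs_re (2 * π * u)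
  refine (hsinh.mul (((hpair ha).mul (hpair hb)).mul ((hpair hc).mul (hpair hd)))).congr_right
    fun u => ?_
  simp only [← Real.exp_add]
  ring_nf

theorem shiftedWilsonIntegrand_add_half_mul_I (ha : 0 < a.re) (hb : 0 < b.re) (hc : 0 < c.re)
    (hd : 0 < d.re) (t : ℝ) :
    shiftedWilsonIntegrand a b c d (t + (1 / 2 : ℝ) * I)
      = -Complex.sinh (2 * π * t) * ((a - I * t) * (b - I * t) * (c - I * t) * (d - I * t)
        * (gammaPair a t * gammaPair b t * gammaPair c t * gammaPair d t)) := by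
  have harg : 2 * π * (t + (1 / 2 : ℝ) * I) = 2 * π * t + π * I := by
    push_cast
    ring
  rw [shiftedWilsonIntegrand, gammaPair_add_half_mul_I ha, gammaPair_add_half_mul_I hb,
    gammaPair_add_half_mul_I hc, gammaPair_add_half_mul_I hd, harg, Complex.sinh_add_pi_mul_I]
  ring

theorem shiftedWilsonIntegrand_neg (a b c d u : ℂ) :
    shiftedWilsonIntegrand a b c d (-u) = -shiftedWilsonIntegrand a b c d u := by
  simp only [shiftedWilsonIntegrand, gammaPair_neg, mul_neg, Complex.sinh_neg, neg_mul]

theorem shiftedWilsonIntegrand_sub_half_mul_I (ha : 0 < a.re) (hb : 0 < b.re) (hc : 0 < c.re)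
    (hd : 0 < d.re) (t : ℝ) :
    shiftedWilsonIntegrand a b c d (t + (-(1 / 2) : ℝ) * I)
      = -Complex.sinh (2 * π * t) * ((a + I * t) * (b + I * t) * (c + I * t) * (d + I * t)
        * (gammaPair a t * gammaPair b t * gammaPair c t * gammaPair d t)) := by
  have harg : (t + (-(1 / 2) : ℝ) * I : ℂ) = -((-t : ℝ) + (1 / 2 : ℝ) * I) := by
    push_cast
    ring
  rw [harg, shiftedWilsonIntegrand_neg, shiftedWilsonIntegrand_add_half_mul_I ha hb hc hd]
  simp only [Complex.ofReal_neg, gammaPair_neg, mul_neg, Complex.sinh_neg, sub_neg_eq_add]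
  ring

theorem wilsonIntegrand_add_one_sub (ha : 0 < a.re) (hb : 0 < b.re) (hc : 0 < c.re)
    (hd : 0 < d.re) (t : ℝ) :
    (a + b + c + d) * (gammaPair (a + 1) t * continuousDualHahnWeight b c d t)
        - (a + b) * (a + c) * (a + d) * (gammaPair a t * continuousDualHahnWeight b c d t)
      = 1 / (π * I) * (shiftedWilsonIntegrand a b c d (t + (-(1 / 2) : ℝ) * I)
        - shiftedWilsonIntegrand a b c d (t + (1 / 2 : ℝ) * I)) := by
  have hpoly : (a + I * t) * (b + I * t) * (c + I * t) * (d + I * t)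
        - (a - I * t) * (b - I * t) * (c - I * t) * (d - I * t)
      = -(2 * I * t) * ((a + b + c + d) * (a ^ 2 + t ^ 2) - (a + b) * (a + c) * (a + d)) := by
    linear_combination (2 * I * t ^ 3 * (a + b + c + d)) * Complex.I_sq
  rw [shiftedWilsonIntegrand_sub_half_mul_I ha hb hc hd,
    shiftedWilsonIntegrand_add_half_mul_I ha hb hc hd, ← mul_sub, ← sub_mul, hpoly,
    gammaPair_add_one ha, continuousDualHahnWeight, wilsonDensity]
  field_simp

theorem wilsonIntegral_add_one (ha : 0 < a.re) (hb : 0 < b.re) (hc : 0 < c.re) (hd : 0 < d.re) :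
    (a + b + c + d) * wilsonIntegral (a + 1) b c d
      = (a + b) * (a + c) * (a + d) * wilsonIntegral a b c d := by
  have hstrip : {u : ℂ | |u.im| ≤ 1 / 2} = {u | u.im ∈ uIcc (-(1 / 2) : ℝ) (1 / 2)} := by
    simp only [uIcc_of_le (by norm_num : -(1 / 2) ≤ (1 / 2 : ℝ)), mem_Icc, abs_le]
  have hdiff := differentiableOn_shiftedWilsonIntegrand ha hb hc hd
  have hbound := shiftedWilsonIntegrand_isBigO_exp ha hb hc hd
  rw [hstrip] at hdiff hbound
  have hexp : Integrable fun t => rexp (-(12 - 2 * π) * |t|) :=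
    integrable_exp_neg_mul_abs (by linarith [Real.pi_lt_d2])
  have hshift := integral_horizontal_eq hdiff hbound hexp
  have ha' : 0 < (a + 1).re := by
    rw [Complex.add_re, Complex.one_re]
    positivity
  rw [← sub_eq_zero, wilsonIntegral, wilsonIntegral, ← integral_const_mul, ← integral_const_mul,
    ← integral_sub ((integrable_gammaPair_mul_continuousDualHahnWeight ha' hb hc hd).const_mul _)
      ((integrable_gammaPair_mul_continuousDualHahnWeight ha hb hc hd).const_mul _)]
  simp only [wilsonIntegrand_add_one_sub ha hb hc hd]
  rw [integral_const_mul, integral_sub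
    (integrable_comp_add_mul_I hdiff.continuousOn hbound hexp left_mem_uIcc)
    (integrable_comp_add_mul_I hdiff.continuousOn hbound hexp right_mem_uIcc),
    hshift, sub_self, mul_zero]

end Contiguity

section GammaRatio

variable {z : ℂ}

/-- The ratio `Γ(z + n + 1) / (n ^ z n!)`, which normalizes the Gamma function so that it tends
to `1` along `z + ℕ`. -/
noncomputable def gammaRatio (z : ℂ) (n : ℕ) : ℂ := Gamma (z + (n + 1 : ℕ)) / (n ^ z * n.factorial)

theorem Gamma_add_natCast_eq_prod (hz : 0 < z.re) (n : ℕ) :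
    Gamma (z + n) = (∏ j ∈ Finset.range n, (z + j)) * Gamma z := by
  induction n with
  | zero => simp
  | succ n ih =>
    have hne : z + n ≠ 0 := Complex.ne_zero_of_re_pos (add_natCast_re_pos hz n)
    rw [Finset.prod_range_succ, Nat.cast_succ, ← add_assoc, Complex.Gamma_add_one _ hne, ih]
    ring

theorem tendsto_gammaRatio (hz : 0 < z.re) : Tendsto (gammaRatio z) atTop (𝓝 1) := by
  have hΓ := Complex.Gamma_ne_zero_of_re_pos hz
  have hlim := (tendsto_const_nhds (x := Gamma z)).div (Complex.GammaSeq_tendsto_Gamma z) hΓ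
  rw [div_self hΓ] at hlim
  refine hlim.congr fun n => ?_
  rw [Pi.div_apply, gammaRatio, Complex.GammaSeq, Gamma_add_natCast_eq_prod hz,
    div_div_eq_mul_div, mul_comm (Gamma z)]

theorem norm_gammaRatio_le (hz : 0 < z.re) {n : ℕ} (hn : n ≠ 0) :
    ‖gammaRatio z n‖ ≤ ‖gammaRatio z.re n‖ := by
  have hre : (z + (n + 1 : ℕ)).re = z.re + (n + 1 : ℕ) := by simp
  have hpos : 0 < (z + (n + 1 : ℕ)).re := by rw [hre]; positivity
  have hΓ : ‖Gamma (z + (n + 1 : ℕ))‖ ≤ ‖Gamma (z.re + (n + 1 : ℕ))‖ := by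
    rw [← Complex.ofReal_natCast, ← Complex.ofReal_add, Complex.ofReal_natCast, ← hre,
      Complex.Gamma_ofReal, Complex.norm_real]
    exact (norm_Gamma_le_Gamma_re hpos).trans (Real.le_norm_self _)
  simp only [gammaRatio, norm_div, norm_mul,
    Complex.norm_natCast_cpow_of_pos (Nat.pos_of_ne_zero hn), Complex.ofReal_re]
  gcongr

theorem natCast_cpow_mul_factorial_ne_zero (z : ℂ) {n : ℕ} (hn : n ≠ 0) :
    (n : ℂ) ^ z * n.factorial ≠ 0 := by
  simp [Complex.cpow_eq_zero_iff, hn, n.factorial_ne_zero]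

theorem Gamma_add_natCast_eq_gammaRatio_mul (z : ℂ) {n : ℕ} (hn : n ≠ 0) :
    Gamma (z + (n + 1 : ℕ)) = gammaRatio z n * (n ^ z * n.factorial) :=
  (div_mul_cancel₀ _ (natCast_cpow_mul_factorial_ne_zero z hn)).symm

theorem gammaPair_add_natCast (a u : ℂ) {n : ℕ} (hn : n ≠ 0) :
    gammaPair (a + (n + 1 : ℕ)) u
      = gammaRatio (a + I * u) n * gammaRatio (a - I * u) n * (n ^ a * n.factorial) ^ 2 := by
  have hn' : (n : ℂ) ≠ 0 := Nat.cast_ne_zero.2 hn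
  have hcpow : (n : ℂ) ^ (a + I * u) * n ^ (a - I * u) = (n ^ a) ^ 2 := by
    rw [← Complex.cpow_add _ _ hn', sq, ← Complex.cpow_add _ _ hn', add_add_sub_cancel]
  rw [gammaPair, add_right_comm, add_sub_right_comm, Gamma_add_natCast_eq_gammaRatio_mul _ hn,
    Gamma_add_natCast_eq_gammaRatio_mul _ hn]
  linear_combination (gammaRatio (a + I * u) n * gammaRatio (a - I * u) n * n.factorial ^ 2) * hcpow

end GammaRatio

section WilsonIntegral

variable {a b c d : ℂ}

theorem tendsto_wilsonIntegral_add_natCast (ha : 0 < a.re) (hb : 0 < b.re) (hc : 0 < c.re)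
    (hd : 0 < d.re) :
    Tendsto (fun n : ℕ => wilsonIntegral (a + (n + 1 : ℕ)) b c d / (n ^ a * n.factorial) ^ 2) atTop
      (𝓝 (∫ t, continuousDualHahnWeight b c d t)) := by
  have hadd (t : ℝ) : (a + I * t).re = a.re := by simp
  have hsub (t : ℝ) : (a - I * t).re = a.re := by simp
  have hdiv (n : ℕ) (hn : n ≠ 0) (t : ℝ) :
      gammaPair (a + (n + 1 : ℕ)) t * continuousDualHahnWeight b c d t / (n ^ a * n.factorial) ^ 2
        = gammaRatio (a + I * t) n * gammaRatio (a - I * t) n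
          * continuousDualHahnWeight b c d t := by
    rw [gammaPair_add_natCast a t hn, mul_right_comm,
      mul_div_cancel_right₀ _ (pow_ne_zero 2 (natCast_cpow_mul_factorial_ne_zero a hn))]
  have hle : ∀ᶠ n : ℕ in atTop, ‖gammaRatio a.re n‖ ≤ 2 :=
    (tendsto_gammaRatio (z := a.re) (by simpa)).norm.eventually_le_const (by simp)
  simp only [wilsonIntegral, ← integral_div]
  refine tendsto_integral_filter_of_dominated_convergence
    (fun t => 2 * 2 * ‖continuousDualHahnWeight b c d t‖) (.of_forall fun n => ?_) ?_
    ((integrable_continuousDualHahnWeight hb hc hd).norm.const_mul _) (.of_forall fun t => ?_)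
  · have hn : 0 < (a + (n + 1 : ℕ)).re := add_natCast_re_pos ha _
    exact ((integrable_gammaPair_mul_continuousDualHahnWeight hn hb hc hd).div_const
      _).aestronglyMeasurable
  · filter_upwards [hle, eventually_ne_atTop 0] with n hn hn₀
    refine .of_forall fun t => ?_
    have hnadd := norm_gammaRatio_le (z := a + I * t) (by rwa [hadd]) hn₀
    have hnsub := norm_gammaRatio_le (z := a - I * t) (by rwa [hsub]) hn₀
    rw [hadd] at hnadd
    rw [hsub] at hnsub
    rw [hdiv n hn₀, norm_mul, norm_mul]
    gcongr
    exacts [hnadd.trans hn, hnsub.trans hn]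
  · have hlim := ((tendsto_gammaRatio (z := a + I * t) (by rwa [hadd])).mul
      (tendsto_gammaRatio (z := a - I * t) (by rwa [hsub]))).mul_const
      (continuousDualHahnWeight b c d t)
    rw [one_mul, one_mul] at hlim
    refine hlim.congr' ?_
    filter_upwards [eventually_ne_atTop 0] with n hn
    exact (hdiv n hn t).symm

theorem wilsonIntegral_add_natCast (ha : 0 < a.re) (hb : 0 < b.re) (hc : 0 < c.re)
    (hd : 0 < d.re) (n : ℕ) :
    wilsonIntegral (a + n) b c d * Gamma (a + b + c + d + n)
        * (Gamma (a + b) * Gamma (a + c) * Gamma (a + d))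
      = wilsonIntegral a b c d * Gamma (a + b + c + d)
        * (Gamma (a + b + n) * Gamma (a + c + n) * Gamma (a + d + n)) := by
  induction n with
  | zero => simp
  | succ n ih =>
    have hstep := wilsonIntegral_add_one (add_natCast_re_pos ha n) hb hc hd
    have hΓ {z : ℂ} (hz : 0 < z.re) : Gamma (z + (n + 1 : ℕ)) = (z + n) * Gamma (z + n) := by
      rw [Nat.cast_succ, ← add_assoc,
        Complex.Gamma_add_one _ (Complex.ne_zero_of_re_pos (add_natCast_re_pos hz n))]
    rw [hΓ (add_re_pos (add_re_pos (add_re_pos ha hb) hc) hd), hΓ (add_re_pos ha hb),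
      hΓ (add_re_pos ha hc), hΓ (add_re_pos ha hd), Nat.cast_succ, ← add_assoc]
    linear_combination (Gamma (a + b + c + d + n)
      * (Gamma (a + b) * Gamma (a + c) * Gamma (a + d))) * hstep
      + (a + b + n) * (a + c + n) * (a + d + n) * ih

theorem wilsonIntegral_mul_Gamma (ha : 0 < a.re) (hb : 0 < b.re) (hc : 0 < c.re) (hd : 0 < d.re) :
    wilsonIntegral a b c d * Gamma (a + b + c + d)
      = Gamma (a + b) * Gamma (a + c) * Gamma (a + d) * ∫ t, continuousDualHahnWeight b c d t := by
  have hleft := ((tendsto_wilsonIntegral_add_natCast ha hb hc hd).mul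
    (tendsto_gammaRatio (add_re_pos (add_re_pos (add_re_pos ha hb) hc) hd))).mul_const
      (Gamma (a + b) * Gamma (a + c) * Gamma (a + d))
  have hright := (((tendsto_gammaRatio (add_re_pos ha hb)).mul
    (tendsto_gammaRatio (add_re_pos ha hc))).mul
    (tendsto_gammaRatio (add_re_pos ha hd))).const_mul
      (wilsonIntegral a b c d * Gamma (a + b + c + d))
  have heq := tendsto_nhds_unique_of_eventuallyEq hleft hright ?_
  · linear_combination -heq
  · filter_upwards [eventually_ne_atTop 0] with n hn
    have hn' : (n : ℂ) ≠ 0 := Nat.cast_ne_zero.2 hn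
    have hcpow (z : ℂ) : (n : ℂ) ^ z ≠ 0 := by simp [Complex.cpow_eq_zero_iff, hn]
    have hfact : (n.factorial : ℂ) ≠ 0 := Nat.cast_ne_zero.2 n.factorial_ne_zero
    have hnat := wilsonIntegral_add_natCast ha hb hc hd (n + 1)
    simp only [Gamma_add_natCast_eq_gammaRatio_mul _ hn, Complex.cpow_add _ _ hn'] at hnat
    rw [div_mul_eq_mul_div, div_mul_eq_mul_div,
      div_eq_iff (pow_ne_zero 2 (natCast_cpow_mul_factorial_ne_zero a hn))]
    refine mul_right_cancel₀ (mul_ne_zero (mul_ne_zero (mul_ne_zero (mul_ne_zero (hcpow a)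
      (hcpow b)) (hcpow c)) (hcpow d)) hfact) ?_
    linear_combination hnat

end WilsonIntegral

theorem gammaPair_half (t : ℝ) : gammaPair (1 / 2) t = (π / Real.cosh (π * t) : ℝ) := by
  have hsub : (1 / 2 - I * t : ℂ) = 1 - (1 / 2 + I * t) := by ring
  have hsin : Complex.sin (π * (1 / 2 + I * t)) = Complex.cosh (π * t) := by
    rw [← Complex.cos_mul_I, ← Complex.sin_add_pi_div_two]
    ring_nf
  rw [gammaPair, hsub, Complex.Gamma_mul_Gamma_one_sub, hsin]
  push_cast
  rfl

theorem hasDerivAt_gammaPair_half (t : ℝ) :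
    HasDerivAt (fun t : ℝ => gammaPair (1 / 2) t)
      (-(π * Real.sinh (π * t) * π) / Real.cosh (π * t) ^ 2 : ℝ) t := by
  have hlin : HasDerivAt (fun t : ℝ => π * t) π t := hasDerivAt_const_mul π
  simp only [gammaPair_half]
  refine (((hasDerivAt_const t π).div hlin.cosh (Real.cosh_pos _).ne').congr_deriv ?_).ofReal_comp
  ring

theorem integral_pi_div_cosh : ∫ t : ℝ, π / Real.cosh (π * t) = π := by
  have hderiv (t : ℝ) (_ : t ∈ univ) :
      HasDerivWithinAt (fun t => Real.sinh (π * t)) (Real.cosh (π * t) * π) univ t :=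
    (hasDerivAt_const_mul π).sinh.hasDerivWithinAt
  have hinj : InjOn (fun t => Real.sinh (π * t)) univ :=
    (Real.sinh_injective.comp (mul_right_injective₀ Real.pi_ne_zero)).injOn
  have himage : (fun t => Real.sinh (π * t)) '' univ = univ := by
    rw [image_univ]
    exact (Real.sinh_surjective.comp (mul_left_surjective₀ Real.pi_ne_zero)).range_eq
  have hsubst := integral_image_eq_integral_abs_deriv_smul .univ hderiv hinj
    (fun x : ℝ => (1 + x ^ 2)⁻¹)
  rw [himage, setIntegral_univ, setIntegral_univ, integral_univ_inv_one_add_sq] at hsubst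
  refine (integral_congr_ae (.of_forall fun t => ?_)).trans hsubst.symm
  have := Real.cosh_pos (π * t)
  rw [abs_of_pos (by positivity), add_comm, ← Real.cosh_sq, smul_eq_mul]
  field_simp

theorem continuousDualHahnWeight_half (t : ℝ) :
    continuousDualHahnWeight (1 / 2) (1 / 2) (1 / 2) t
      = -4 * (t * (-(π * Real.sinh (π * t) * π) / Real.cosh (π * t) ^ 2 : ℝ)) := by
  have hdouble : wilsonDensity t = (4 * t * Real.sinh (π * t) * Real.cosh (π * t) / π : ℝ) := by
    rw [wilsonDensity, mul_assoc 2 (π : ℂ), Complex.sinh_two_mul]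
    push_cast
    ring
  have := Real.cosh_pos (π * t)
  rw [continuousDualHahnWeight, hdouble, gammaPair_half]
  norm_cast
  field_simp
  push_cast
  ring

theorem integral_continuousDualHahnWeight_half :
    ∫ t, continuousDualHahnWeight (1 / 2) (1 / 2) (1 / 2) t = 4 * π := by
  have hhalf : 0 < (1 / 2 : ℂ).re := by norm_num
  have hdecay : (fun t : ℝ => gammaPair (1 / 2) t) =O[⊤] fun t => rexp (-2 * |t|) := by
    simpa using gammaPair_ofReal_isBigO_exp hhalf zero_le_one (by linarith [Real.pi_gt_three])
  have hlin : (fun t : ℝ => (t : ℂ)) =O[⊤] fun t => rexp |t| := by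
    refine .of_bound 1 (eventually_top.2 fun t => ?_)
    rw [Complex.norm_real, Real.norm_eq_abs, Real.norm_of_nonneg (Real.exp_pos _).le, one_mul]
    linarith [Real.add_one_le_exp |t|]
  have hcont := continuous_gammaPair_ofReal hhalf
  have hint : Integrable fun t : ℝ => gammaPair (1 / 2) t :=
    hdecay.integrable hcont.aestronglyMeasurable (integrable_exp_neg_mul_abs two_pos)
  have hint_mul : Integrable fun t : ℝ => (t : ℂ) * gammaPair (1 / 2) t := by
    refine ((hlin.mul hdecay).congr_right fun t => ?_).integrable
      (Complex.continuous_ofReal.mul hcont).aestronglyMeasurable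
      (integrable_exp_neg_mul_abs one_pos)
    rw [← Real.exp_add]
    ring_nf
  have hint_deriv := (integrable_continuousDualHahnWeight hhalf hhalf hhalf).const_mul (-4)⁻¹
  simp only [continuousDualHahnWeight_half, inv_mul_cancel_left₀ (show (-4 : ℂ) ≠ 0 by norm_num)]
    at hint_deriv ⊢
  have hparts := integral_mul_deriv_eq_deriv_mul_of_integrable
    (fun t _ => Complex.ofRealCLM.hasDerivAt) (fun t _ => hasDerivAt_gammaPair_half t)
    hint_deriv (by simpa [Pi.mul_def] using hint) hint_mul
  simp only [Complex.ofRealCLM_apply, Complex.ofReal_one, one_mul, gammaPair_half,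
    integral_complex_ofReal, integral_pi_div_cosh] at hparts
  rw [integral_const_mul, hparts, neg_mul_neg]

section Evaluation

variable {a b c d : ℂ}

theorem continuousDualHahnWeight_rotate (b c d : ℂ) :
    continuousDualHahnWeight b c d = continuousDualHahnWeight c d b := by
  ext t
  simp only [continuousDualHahnWeight]
  ring

theorem integral_continuousDualHahnWeight_mul_Gamma (ha : 0 < a.re) (hb : 0 < b.re)
    (hc : 0 < c.re) (hd : 0 < d.re) :
    (∫ t, continuousDualHahnWeight b c d t) * (Gamma (a + b) * Gamma (a + c))
      = (∫ t, continuousDualHahnWeight b c a t) * (Gamma (b + d) * Gamma (c + d)) := by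
  have hΓ : Gamma (a + d) ≠ 0 := Complex.Gamma_ne_zero_of_re_pos (add_re_pos ha hd)
  have hleft := wilsonIntegral_mul_Gamma ha hb hc hd
  have hright := wilsonIntegral_mul_Gamma hd hb hc ha
  rw [← wilsonIntegral_swap, add_comm d a, add_comm d b, add_comm d c,
    show b + d + c + a = a + b + c + d by ring, hleft] at hright
  refine mul_left_cancel₀ hΓ ?_
  linear_combination hright

theorem integral_continuousDualHahnWeight (hb : 0 < b.re) (hc : 0 < c.re) (hd : 0 < d.re) :
    ∫ t, continuousDualHahnWeight b c d t
      = 4 * π * (Gamma (b + c) * Gamma (b + d) * Gamma (c + d)) := by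
  have hhalf : 0 < (1 / 2 : ℂ).re := by norm_num
  have hΓ {z : ℂ} (hz : 0 < z.re) : Gamma (1 / 2 + z) ≠ 0 :=
    Complex.Gamma_ne_zero_of_re_pos (add_re_pos hhalf hz)
  -- Symmetry of the weight allows each parameter in turn to be traded for `1 / 2`.
  have hfirst := integral_continuousDualHahnWeight_mul_Gamma hhalf hb hc hd
  have hsecond := integral_continuousDualHahnWeight_mul_Gamma hhalf hhalf hb hc
  have hthird := integral_continuousDualHahnWeight_mul_Gamma hhalf hhalf hhalf hb
  rw [← continuousDualHahnWeight_rotate (1 / 2) b c] at hfirst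
  rw [← continuousDualHahnWeight_rotate (1 / 2) (1 / 2) b] at hsecond
  rw [add_halves, Complex.Gamma_one] at hsecond hthird
  rw [integral_continuousDualHahnWeight_half] at hthird
  refine mul_right_cancel₀ (mul_ne_zero (hΓ hb) (mul_ne_zero (hΓ hb) (hΓ hc))) ?_
  linear_combination Gamma (1 / 2 + b) * hfirst
    + Gamma (b + d) * Gamma (c + d) * hsecond
    + Gamma (1 / 2 + c) * Gamma (b + c) * Gamma (b + d) * Gamma (c + d) * hthird

theorem wilsonIntegral_eq (ha : 0 < a.re) (hb : 0 < b.re) (hc : 0 < c.re) (hd : 0 < d.re) :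
    wilsonIntegral a b c d
      = 4 * π * (Gamma (a + b) * Gamma (a + c) * Gamma (a + d) * Gamma (b + c) * Gamma (b + d)
        * Gamma (c + d)) / Gamma (a + b + c + d) := by
  have hΓ : Gamma (a + b + c + d) ≠ 0 :=
    Complex.Gamma_ne_zero_of_re_pos (add_re_pos (add_re_pos (add_re_pos ha hb) hc) hd)
  rw [eq_div_iff hΓ, wilsonIntegral_mul_Gamma ha hb hc hd,
    integral_continuousDualHahnWeight hb hc hd]
  ring

end Evaluation

/-! ### The inner Givental integral -/

section Beta

variable {u v : ℂ}

theorem abs_deriv_sigmoid_smul_beta (u v : ℂ) (t : ℝ) :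
    |t.sigmoid * (1 - t.sigmoid)| •
        ((t.sigmoid : ℂ) ^ (u - 1) * (1 - (t.sigmoid : ℂ)) ^ (v - 1))
      = cexp (u * Real.log t.sigmoid + v * Real.log (-t).sigmoid) := by
  have hpos := Real.sigmoid_pos t
  have hpos' := Real.sigmoid_pos (-t)
  have hcpow {r : ℝ} (hr : 0 < r) (z : ℂ) : (r : ℂ) ^ (z - 1) = cexp (z * Real.log r) / r := by
    have hne : (r : ℂ) ≠ 0 := Complex.ofReal_ne_zero.2 hr.ne'
    rw [Complex.cpow_sub _ _ hne, Complex.cpow_one, Complex.cpow_def_of_ne_zero hne,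
      Complex.ofReal_log hr.le, mul_comm z]
  rw [← Complex.ofReal_one, ← Complex.ofReal_sub, ← Real.sigmoid_neg,
    abs_of_pos (mul_pos hpos hpos'), Complex.ofReal_one, hcpow hpos, hcpow hpos', Complex.exp_add,
    Complex.real_smul]
  have hne : (t.sigmoid : ℂ) ≠ 0 := Complex.ofReal_ne_zero.2 hpos.ne'
  have hne' : ((-t).sigmoid : ℂ) ≠ 0 := Complex.ofReal_ne_zero.2 hpos'.ne'
  push_cast
  field_simp

theorem image_sigmoid_univ : Real.sigmoid '' univ = Ioo 0 1 := by
  rw [image_univ, Real.range_sigmoid]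

theorem integrable_exp_log_sigmoid (hu : 0 < u.re) (hv : 0 < v.re) :
    Integrable fun t : ℝ => cexp (u * Real.log t.sigmoid + v * Real.log (-t).sigmoid) := by
  have hbeta := (intervalIntegrable_iff_integrableOn_Ioo_of_le zero_le_one).1
    (Complex.betaIntegral_convergent hu hv)
  rw [← image_sigmoid_univ, integrableOn_image_iff_integrableOn_abs_deriv_smul .univ
    (fun t _ => (Real.hasDerivAt_sigmoid t).hasDerivWithinAt) Real.sigmoid_injective.injOn,
    integrableOn_univ] at hbeta
  simpa only [abs_deriv_sigmoid_smul_beta] using hbeta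

theorem integral_exp_log_sigmoid (hu : 0 < u.re) (hv : 0 < v.re) :
    ∫ t : ℝ, cexp (u * Real.log t.sigmoid + v * Real.log (-t).sigmoid)
      = Gamma u * Gamma v / Gamma (u + v) := by
  have hΓ : Gamma (u + v) ≠ 0 := Complex.Gamma_ne_zero_of_re_pos (add_re_pos hu hv)
  rw [Complex.Gamma_mul_Gamma_eq_betaIntegral hu hv, mul_div_cancel_left₀ _ hΓ,
    Complex.betaIntegral, intervalIntegral.integral_of_le zero_le_one, integral_Ioc_eq_integral_Ioo,
    ← image_sigmoid_univ, integral_image_eq_integral_abs_deriv_smul .univ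
      (fun t _ => (Real.hasDerivAt_sigmoid t).hasDerivWithinAt) Real.sigmoid_injective.injOn]
  simp only [abs_deriv_sigmoid_smul_beta, setIntegral_univ]

end Beta

section InnerGivental

variable {α β δ : ℂ}

/-- The part of the Givental integrand, in the variables `(T₁₁, T₂₁, T₂₂)`, that is left when the
factors that involve `x₁` and `x₃` are replaced by exponentials of `T₂₁` and `T₂₂`; the parameter
`ξ` stands for `x₂`. -/
noncomputable def innerGivental (α β δ : ℂ) (ξ : ℝ) : ℝ × ℝ × ℝ → ℂ :=
  fun (T₁₁, T₂₁, T₂₂) =>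
    cexp (α * T₂₁ - β * T₂₂ + δ * T₁₁
      - (rexp (T₂₁ - ξ) + rexp (ξ - T₂₂) + rexp (T₂₁ - T₁₁) + rexp (T₁₁ - T₂₂) : ℝ))

/-- The change of variables that turns `innerGivental` into a product of functions of one
variable. -/
noncomputable def giventalShear (ξ : ℝ) (y : ℝ × ℝ × ℝ) : ℝ × ℝ × ℝ :=
  (y.1 + ξ, y.2.1 + (ξ + Real.log y.1.sigmoid), y.2.2 + (ξ - Real.log (-y.1).sigmoid))

theorem measurePreserving_giventalShear (ξ : ℝ) : MeasurePreserving (giventalShear ξ) := by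
  have hσ : Measurable Real.sigmoid := continuous_sigmoid.measurable
  refine (measurePreserving_add_right volume ξ).skew_product
    (g := fun t (p : ℝ × ℝ) => (p.1 + (ξ + Real.log t.sigmoid), p.2 + (ξ - Real.log (-t).sigmoid)))
    (by unfold Function.uncurry; fun_prop) (.of_forall fun t => ?_)
  exact ((measurePreserving_add_right volume _).prod (measurePreserving_add_right volume _)).map_eq

theorem innerGivental_giventalShear (α β δ : ℂ) (ξ : ℝ) (y : ℝ × ℝ × ℝ) :
    innerGivental α β δ ξ (giventalShear ξ y)
      = cexp ((α - β + δ) * ξ) *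
        (cexp ((α + δ) * Real.log y.1.sigmoid + (β - δ) * Real.log (-y.1).sigmoid) *
          (cexp (α * y.2.1 - cexp y.2.1) * cexp (β * (-y.2.2 : ℝ) - cexp (-y.2.2 : ℝ)))) := by
  obtain ⟨t, p, q⟩ := y
  have hσ := Real.sigmoid_pos t
  have hσ' := Real.sigmoid_pos (-t)
  have hmul : t.sigmoid * rexp (-t) = (-t).sigmoid := Real.sigmoid_mul_rexp_neg t
  have hmul' : (-t).sigmoid * rexp t = t.sigmoid := by simpa using Real.sigmoid_mul_rexp_neg (-t)
  have hadd : (-t).sigmoid = 1 - t.sigmoid := Real.sigmoid_neg t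
  have hlog : t = Real.log t.sigmoid - Real.log (-t).sigmoid := by
    rw [← hmul, Real.log_mul hσ.ne' (Real.exp_ne_zero _), Real.log_exp]
    ring
  have hp : rexp (p + (ξ + Real.log t.sigmoid) - ξ)
      + rexp (p + (ξ + Real.log t.sigmoid) - (t + ξ)) = rexp p := by
    rw [show p + (ξ + Real.log t.sigmoid) - ξ = p + Real.log t.sigmoid by ring,
      show p + (ξ + Real.log t.sigmoid) - (t + ξ) = p + (Real.log t.sigmoid + -t) by ring,
      Real.exp_add, Real.exp_add, Real.exp_add, Real.exp_log hσ, hmul, hadd]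
    ring
  have hq : rexp (ξ - (q + (ξ - Real.log (-t).sigmoid)))
      + rexp (t + ξ - (q + (ξ - Real.log (-t).sigmoid))) = rexp (-q) := by
    rw [show ξ - (q + (ξ - Real.log (-t).sigmoid)) = -q + Real.log (-t).sigmoid by ring,
      show t + ξ - (q + (ξ - Real.log (-t).sigmoid)) = -q + (Real.log (-t).sigmoid + t) by ring,
      Real.exp_add, Real.exp_add, Real.exp_add, Real.exp_log hσ', hmul', hadd]
    ring
  have hlog' := congrArg Complex.ofReal hlog
  have hp' := congrArg Complex.ofReal hp
  have hq' := congrArg Complex.ofReal hq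
  push_cast at hlog' hp' hq'
  simp only [innerGivental, giventalShear, ← Complex.exp_add]
  congr 1
  push_cast
  linear_combination δ * hlog' - hp' - hq'

theorem continuous_innerGivental (α β δ : ℂ) (ξ : ℝ) : Continuous (innerGivental α β δ ξ) := by
  unfold innerGivental
  fun_prop

theorem integrable_innerGivental (hα : 0 < α.re) (hβ : 0 < β.re) (hαδ : 0 < (α + δ).re)
    (hβδ : 0 < (β - δ).re) (ξ : ℝ) : Integrable (innerGivental α β δ ξ) := by
  refine ((measurePreserving_giventalShear ξ).integrable_comp
    (continuous_innerGivental α β δ ξ).aestronglyMeasurable).1 ?_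
  have hprod := (integrable_exp_log_sigmoid hαδ hβδ).mul_prod
    ((integrable_exp_mul_sub_exp hα).mul_prod (integrable_exp_mul_sub_exp hβ).comp_neg)
  exact (hprod.const_mul (cexp ((α - β + δ) * ξ))).congr
    (.of_forall fun y => (innerGivental_giventalShear α β δ ξ y).symm)

theorem integral_innerGivental (hα : 0 < α.re) (hβ : 0 < β.re) (hαδ : 0 < (α + δ).re)
    (hβδ : 0 < (β - δ).re) (ξ : ℝ) :
    ∫ T, innerGivental α β δ ξ T
      = cexp ((α - β + δ) * ξ)
        * (Gamma α * Gamma β * Gamma (α + δ) * Gamma (β - δ) / Gamma (α + β)) := by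
  have hmp := measurePreserving_giventalShear ξ
  rw [← hmp.map_eq, integral_map hmp.aemeasurable
    (continuous_innerGivental α β δ ξ).aestronglyMeasurable]
  simp only [innerGivental_giventalShear]
  rw [integral_const_mul, Measure.volume_eq_prod, integral_prod_mul
    (fun t : ℝ => cexp ((α + δ) * Real.log t.sigmoid + (β - δ) * Real.log (-t).sigmoid))
    (fun p : ℝ × ℝ => cexp (α * p.1 - cexp p.1) * cexp (β * (-p.2 : ℝ) - cexp (-p.2 : ℝ))),
    Measure.volume_eq_prod, integral_prod_mul (fun p : ℝ => cexp (α * p - cexp p))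
    (fun q : ℝ => cexp (β * (-q : ℝ) - cexp (-q : ℝ))),
    integral_exp_log_sigmoid hαδ hβδ, integral_exp_mul_sub_exp hα,
    integral_neg_eq_self (fun q : ℝ => cexp (β * q - cexp q)), integral_exp_mul_sub_exp hβ,
    add_add_sub_cancel]
  ring

end InnerGivental

section MellinInversion

variable {c : ℂ}

/-- The integrand, in the variable `τ`, of the inverse Mellin transform of the Gamma function at
the point `exp y`, along the vertical line through `c`. -/
noncomputable def inverseMellinGamma (c : ℂ) (y τ : ℝ) : ℂ :=
  Gamma (c - I * τ) * cexp (-(c - I * τ) * y)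

theorem integrable_Gamma_vertical (hc : 0 < c.re) :
    Integrable fun τ : ℝ => Gamma (c - I * τ) := by
  have hbound : (fun τ : ℝ => Gamma (c - I * τ)) =O[⊤] fun τ => rexp (-1 * |τ|) := by
    refine Gamma_comp_isBigO_exp (b := c.re) (C := |c.im|) hc zero_le_one
      (by linarith [Real.pi_gt_three]) (by simp) fun τ => ?_
    simpa [abs_sub_comm] using abs_sub_abs_le_abs_sub τ c.im
  exact hbound.integrable (continuous_Gamma_comp (by fun_prop) (by simpa)).aestronglyMeasurable
    (integrable_exp_neg_mul_abs one_pos)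

theorem mellin_exp_neg {s : ℂ} (hs : 0 < s.re) :
    mellin (fun x : ℝ => (rexp (-x) : ℂ)) s = Gamma s := by
  rw [← Complex.GammaIntegral_eq_mellin, Complex.Gamma_eq_integral hs]

theorem integral_inverseMellinGamma (hc : 0 < c.re) (y : ℝ) :
    ∫ τ, inverseMellinGamma c y τ = 2 * π * cexp (-cexp y) := by
  have hre (t : ℝ) : 0 < ((c.re : ℂ) + t * I).re := by simpa
  have hrefl (t : ℝ) : c - I * (c.im - t : ℝ) = c.re + t * I := by
    apply Complex.ext <;> simp
  have hconv : MellinConvergent (fun x : ℝ => (rexp (-x) : ℂ)) c.re :=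
    (Complex.GammaIntegral_convergent (s := c.re) (by simpa)).congr_fun
      (fun x _ => by rw [smul_eq_mul, mul_comm]) measurableSet_Ioi
  have hvert : Complex.VerticalIntegrable (mellin fun x : ℝ => (rexp (-x) : ℂ)) c.re := by
    refine ((integrable_Gamma_vertical hc).comp_sub_left c.im).congr (.of_forall fun t => ?_)
    simp only [hrefl, mellin_exp_neg (hre t)]
  have hinv := mellinInv_mellin_eq c.re _ (Real.exp_pos y) hconv hvert (by fun_prop)
  simp only [mellinInv, mellin_exp_neg (hre _), ofReal_exp_cpow, smul_eq_mul] at hinv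
  have hpi : (2 * π : ℂ) ≠ 0 := by simp [Real.pi_ne_zero]
  have hcast : cexp (-cexp y) = (rexp (-rexp y) : ℂ) := by push_cast; rfl
  rw [hcast, ← hinv, Complex.real_smul, ← integral_sub_left_eq_self _ _ c.im]
  push_cast
  rw [← mul_assoc, mul_one_div_cancel hpi, one_mul]
  refine integral_congr_ae (.of_forall fun t => ?_)
  simp only [inverseMellinGamma, hrefl]
  ring_nf

end MellinInversion

section Exchange

variable {α β δ a b : ℂ} {y₁ y₂ : ℝ}

/-- The integrand `innerGivental` with the factors that involve `x₁` and `x₃` put back; the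
parameters `y₁` and `y₂` stand for `x₁` and `x₃`. -/
noncomputable def outerGivental (α β δ : ℂ) (y₁ ξ y₂ : ℝ) (T : ℝ × ℝ × ℝ) : ℂ :=
  innerGivental α β δ ξ T *
    (cexp (-cexp (y₁ - T.2.1 : ℝ)) * cexp (-cexp (T.2.2 - y₂ : ℝ)))

/-- The integrand `outerGivental` with its last two factors replaced by the integrands of their
Mellin–Barnes representations along the vertical lines through `a` and `b`. -/
noncomputable def mixedGivental (α β δ a b : ℂ) (y₁ ξ y₂ : ℝ) (q : (ℝ × ℝ × ℝ) × (ℝ × ℝ)) : ℂ :=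
  innerGivental α β δ ξ q.1 *
    (inverseMellinGamma a (y₁ - q.1.2.1) q.2.1 * inverseMellinGamma b (q.1.2.2 - y₂) q.2.2)

theorem mixedGivental_eq (α β δ a b : ℂ) (y₁ ξ y₂ : ℝ) (T : ℝ × ℝ × ℝ) (w : ℝ × ℝ) :
    mixedGivental α β δ a b y₁ ξ y₂ (T, w)
      = Gamma (a - I * w.1) * Gamma (b - I * w.2)
        * cexp ((b - I * w.2) * y₂ - (a - I * w.1) * y₁)
        * innerGivental (α + (a - I * w.1)) (β + (b - I * w.2)) δ ξ T := by
  have hexp (z₁ z₂ z₃ : ℂ) (g₁ g₂ : ℂ) :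
      cexp z₁ * (g₁ * cexp z₂ * (g₂ * cexp z₃)) = g₁ * g₂ * cexp (z₁ + z₂ + z₃) := by
    rw [Complex.exp_add, Complex.exp_add]
    ring
  rw [mixedGivental, inverseMellinGamma, inverseMellinGamma, innerGivental, innerGivental, hexp,
    mul_assoc _ (cexp _) (cexp _), ← Complex.exp_add]
  push_cast
  ring_nf

theorem continuous_mixedGivental (α β δ : ℂ) (ha : 0 < a.re) (hb : 0 < b.re) (y₁ ξ y₂ : ℝ) :
    Continuous (mixedGivental α β δ a b y₁ ξ y₂) := by
  have hΓ {c : ℂ} (hc : 0 < c.re) {f : (ℝ × ℝ × ℝ) × (ℝ × ℝ) → ℝ} (hf : Continuous f) :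
      Continuous fun q => Gamma (c - I * f q) :=
    continuous_Gamma_comp (by fun_prop) (by simpa)
  have hinner := (continuous_innerGivental α β δ ξ).comp (continuous_fst (Y := ℝ × ℝ))
  exact hinner.mul (((hΓ ha (by fun_prop)).mul (by fun_prop)).mul
    ((hΓ hb (by fun_prop)).mul (by fun_prop)))

theorem norm_innerGivental_eq_of_re_eq {α' β' : ℂ} (hα : α'.re = α.re) (hβ : β'.re = β.re)
    (ξ : ℝ) (T : ℝ × ℝ × ℝ) : ‖innerGivental α' β' δ ξ T‖ = ‖innerGivental α β δ ξ T‖ := by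
  simp only [innerGivental, Complex.norm_exp, Complex.sub_re, Complex.add_re,
    Complex.re_mul_ofReal, hα, hβ]

theorem integrable_mixedGivental (ha : 0 < a.re) (hb : 0 < b.re) (hα : 0 < (α + a).re)
    (hβ : 0 < (β + b).re) (hαδ : 0 < (α + a + δ).re) (hβδ : 0 < (β + b - δ).re) (y₁ ξ y₂ : ℝ) :
    Integrable (mixedGivental α β δ a b y₁ ξ y₂) := by
  have hprod := (integrable_innerGivental hα hβ hαδ hβδ ξ).mul_prod
    ((integrable_Gamma_vertical ha).mul_prod (integrable_Gamma_vertical hb))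
  refine (hprod.const_mul (cexp (b.re * y₂ - a.re * y₁))).congr'
    (continuous_mixedGivental α β δ ha hb y₁ ξ y₂).aestronglyMeasurable (.of_forall fun q => ?_)
  obtain ⟨T, w⟩ := q
  have hnorm : ‖innerGivental (α + (a - I * w.1)) (β + (b - I * w.2)) δ ξ T‖
      = ‖innerGivental (α + a) (β + b) δ ξ T‖ :=
    norm_innerGivental_eq_of_re_eq (by simp) (by simp) ξ T
  have hphase : ‖cexp ((b - I * w.2) * y₂ - (a - I * w.1) * y₁)‖
      = ‖cexp (b.re * y₂ - a.re * y₁)‖ := by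
    simp [Complex.norm_exp]
  rw [mixedGivental_eq]
  simp only [norm_mul, hnorm, hphase]
  ring

theorem integral_mixedGivental_snd (α β δ : ℂ) (ha : 0 < a.re) (hb : 0 < b.re) (y₁ ξ y₂ : ℝ)
    (T : ℝ × ℝ × ℝ) :
    ∫ w, mixedGivental α β δ a b y₁ ξ y₂ (T, w) = (2 * π) ^ 2 * outerGivental α β δ y₁ ξ y₂ T := by
  simp only [mixedGivental]
  rw [integral_const_mul, Measure.volume_eq_prod, integral_prod_mul, integral_inverseMellinGamma ha,
    integral_inverseMellinGamma hb, outerGivental]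
  ring

theorem integrable_outerGivental (ha : 0 < a.re) (hb : 0 < b.re) (hα : 0 < (α + a).re)
    (hβ : 0 < (β + b).re) (hαδ : 0 < (α + a + δ).re) (hβδ : 0 < (β + b - δ).re) (y₁ ξ y₂ : ℝ) :
    Integrable (outerGivental α β δ y₁ ξ y₂) := by
  have hint := (integrable_mixedGivental ha hb hα hβ hαδ hβδ y₁ ξ y₂).integral_prod_left
  simp only [integral_mixedGivental_snd α β δ ha hb] at hint
  have hpi : (2 * π : ℂ) ^ 2 ≠ 0 := by simp [Real.pi_ne_zero]
  exact (integrable_const_mul_iff hpi.isUnit _).1 hint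

theorem integral_outerGivental (ha : 0 < a.re) (hb : 0 < b.re) (hα : 0 < (α + a).re)
    (hβ : 0 < (β + b).re) (hαδ : 0 < (α + a + δ).re) (hβδ : 0 < (β + b - δ).re) (y₁ ξ y₂ : ℝ) :
    (2 * π) ^ 2 * ∫ T, outerGivental α β δ y₁ ξ y₂ T
      = ∫ w : ℝ × ℝ, Gamma (a - I * w.1) * Gamma (b - I * w.2)
        * cexp ((b - I * w.2) * y₂ - (a - I * w.1) * y₁)
        * ∫ T, innerGivental (α + (a - I * w.1)) (β + (b - I * w.2)) δ ξ T := by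
  calc (2 * π) ^ 2 * ∫ T, outerGivental α β δ y₁ ξ y₂ T
      = ∫ T, ∫ w, mixedGivental α β δ a b y₁ ξ y₂ (T, w) := by
        simp only [integral_mixedGivental_snd α β δ ha hb, integral_const_mul]
    _ = ∫ w, ∫ T, mixedGivental α β δ a b y₁ ξ y₂ (T, w) :=
        integral_integral_swap (f := fun T w => mixedGivental α β δ a b y₁ ξ y₂ (T, w))
          (integrable_mixedGivental ha hb hα hβ hαδ hβδ y₁ ξ y₂)
    _ = _ := by simp only [mixedGivental_eq, integral_const_mul]

end Exchange

/-! ### Reduction of the Givental integral to Bump's integral -/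

/-- The kernel of Bump's double Mellin–Barnes integral for the `gl₃(ℝ)`-Whittaker function, the
common value of the Givental and the Mellin–Barnes integral. It is integrated over vertical lines
to the right of the poles of the numerator. -/
noncomputable def bumpKernel (γ : Fin 3 → ℂ) (x : Fin 3 → ℝ) (s₁ s₂ : ℂ) : ℂ :=
  cexp (I * (∑ j, γ j) * x 2 - s₁ * (x 0 - x 1) - s₂ * (x 1 - x 2))
    * (∏ i, Gamma (s₁ + I * γ i) * Gamma (s₂ + I * (∑ j, γ j - γ i)))
    / Gamma (s₁ + s₂ + I * ∑ j, γ j)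

section Givental

variable {γ : Fin 3 → ℂ} {c₁ c₂ : ℝ}

theorem giventalIntegrand_eq_outerGivental (γ : Fin 3 → ℂ) (x : Fin 3 → ℝ) :
    giventalIntegrand γ x = outerGivental (I * (γ 1 - γ 2)) (-(I * (γ 1 - γ 2)))
      (I * (γ 0 - γ 1)) (x 0) (x 1) (x 2) := by
  ext ⟨T₁₁, T₂₁, T₂₂⟩
  simp only [giventalIntegrand, outerGivental, innerGivental, Complex.ofReal_exp,
    ← Complex.exp_add]
  push_cast
  ring_nf

theorem integrable_giventalIntegrand (γ : Fin 3 → ℂ) (x : Fin 3 → ℝ) :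
    Integrable (giventalIntegrand γ x) := by
  obtain ⟨M₁, hM₁⟩ := (finite_range fun i => (γ i).im).bddAbove
  obtain ⟨M₂, hM₂⟩ := (finite_range fun i => (∑ j, γ j - γ i).im).bddAbove
  have h₁ (i : Fin 3) : (γ i).im ≤ M₁ := hM₁ ⟨i, rfl⟩
  have h₂ (i : Fin 3) : (∑ j, γ j - γ i).im ≤ M₂ := hM₂ ⟨i, rfl⟩
  simp only [Fin.sum_univ_three, Complex.sub_im, Complex.add_im] at h₂
  rw [giventalIntegrand_eq_outerGivental]
  refine integrable_outerGivental (a := ↑(M₁ + 1) + I * γ 2) (b := ↑(M₂ + 1) + I * (γ 0 + γ 1))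
    ?_ ?_ ?_ ?_ ?_ ?_ _ _ _ <;> simp <;> linarith [h₁ 0, h₁ 1, h₁ 2, h₂ 0, h₂ 1, h₂ 2]

theorem giventalIntegral_eq_integral_bumpKernel (hc₁ : ∀ i, (γ i).im < c₁)
    (hc₂ : ∀ i, (∑ j, γ j - γ i).im < c₂) (x : Fin 3 → ℝ) :
    (2 * π) ^ 2 * giventalIntegral γ x
      = ∫ w : ℝ × ℝ, bumpKernel γ x (c₁ - I * w.1) (c₂ - I * w.2) := by
  have h₁ (i : Fin 3) := hc₁ i
  have h₂ (i : Fin 3) := hc₂ i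
  simp only [Fin.sum_univ_three, Complex.sub_im, Complex.add_im] at h₂
  have houter := integral_outerGivental (a := c₁ + I * γ 2) (b := c₂ + I * (γ 0 + γ 1))
    (α := I * (γ 1 - γ 2)) (β := -(I * (γ 1 - γ 2))) (δ := I * (γ 0 - γ 1))
    (by simp; linarith [h₁ 2]) (by simp; linarith [h₂ 2]) (by simp; linarith [h₁ 1])
    (by simp; linarith [h₂ 1]) (by simp; linarith [h₁ 0]) (by simp; linarith [h₂ 0])
    (x 0) (x 1) (x 2)
  rw [← giventalIntegrand_eq_outerGivental] at houter
  rw [giventalIntegral, mul_left_comm, houter, ← integral_const_mul]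
  refine integral_congr_ae (.of_forall fun w => ?_)
  have hinner := integral_innerGivental (α := I * (γ 1 - γ 2) + (c₁ + I * γ 2 - I * w.1))
    (β := -(I * (γ 1 - γ 2)) + (c₂ + I * (γ 0 + γ 1) - I * w.2)) (δ := I * (γ 0 - γ 1))
    (by simp; linarith [h₁ 1]) (by simp; linarith [h₂ 1]) (by simp; linarith [h₁ 0])
    (by simp; linarith [h₂ 0]) (x 1)
  simp only [hinner, bumpKernel, Fin.prod_univ_three, Fin.sum_univ_three]
  have hexp (z₁ z₂ z₃ g₁ g₂ g : ℂ) :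
      cexp z₁ * (g₁ * g₂ * cexp z₂ * (cexp z₃ * g)) = cexp (z₁ + z₂ + z₃) * (g₁ * g₂ * g) := by
    rw [Complex.exp_add, Complex.exp_add]
    ring
  rw [hexp]
  ring_nf

end Givental

/-! ### Integrability of the Mellin–Barnes integrand -/

theorem mellinBarnesIntegrand_eq (γ : Fin 3 → ℂ) (x : Fin 3 → ℝ) (t u v : ℝ) :
    mellinBarnesIntegrand γ x (t, u, v)
      = wilsonDensity ((u - v) / 2 : ℝ)
        * cexp ((((x 1 - x 2) * (u + v) + (x 0 - x 1) * t : ℝ) : ℂ) * I)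
        * Gamma (I * (u - t) + 1 / 2) * Gamma (I * (v - t) + 1 / 2)
        * ∏ i, (Gamma (I * (γ i - u) + 1 / 2) * Gamma (I * (γ i - v) + 1 / 2)) := by
  rw [mellinBarnesIntegrand, ← one_div_Gamma_mul_Gamma_neg]
  push_cast
  ring_nf

theorem Gamma_I_mul_sub_add_half_isBigO_exp {X : Type*} {g : ℂ} (hg : g.im < 1 / 2) (p : X → ℝ) :
    (fun q => Gamma (I * (g - p q) + 1 / 2)) =O[⊤] fun q => rexp (-(3 / 2) * |p q|) := by
  have hre (q : X) : (I * (g - p q) + 1 / 2).re = 1 / 2 - g.im := by simp; ring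
  have him (q : X) : (I * (g - p q) + 1 / 2).im = g.re - p q := by simp
  refine Gamma_comp_isBigO_exp (b := 1 / 2 - g.im) (C := |g.re|) (sub_pos.2 hg) (by norm_num)
    (by linarith [Real.pi_gt_three]) (.of_forall fun q => ⟨(hre q).ge, (hre q).le⟩) fun q => ?_
  rw [him, abs_sub_comm]
  exact abs_sub_abs_le_abs_sub _ _

section MellinBarnes

variable {γ : Fin 3 → ℂ}

theorem continuous_mellinBarnesIntegrand (hγ : ∀ i, (γ i).im < 1 / 2) (x : Fin 3 → ℝ) :
    Continuous (mellinBarnesIntegrand γ x) := by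
  have hΓ {g : ℂ} (hg : g.im < 1 / 2) {p : ℝ × ℝ × ℝ → ℝ} (hp : Continuous p) :
      Continuous fun τ => Gamma (I * (g - p τ) + 1 / 2) :=
    continuous_Gamma_comp (by fun_prop) fun τ => by simp; linarith
  have hΓ₀ {p : ℝ × ℝ × ℝ → ℝ} (hp : Continuous p) :
      Continuous fun τ => Gamma (I * (p τ - τ.1) + 1 / 2) :=
    continuous_Gamma_comp (by fun_prop) fun τ => by simp
  have hdensity : Continuous fun τ : ℝ × ℝ × ℝ => wilsonDensity ((τ.2.1 - τ.2.2) / 2 : ℝ) := by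
    unfold wilsonDensity
    fun_prop
  have hphase : Continuous fun τ : ℝ × ℝ × ℝ =>
      cexp ((((x 1 - x 2) * (τ.2.1 + τ.2.2) + (x 0 - x 1) * τ.1 : ℝ) : ℂ) * I) := by
    fun_prop
  have hu : Continuous fun τ : ℝ × ℝ × ℝ => τ.2.1 := by fun_prop
  have hv : Continuous fun τ : ℝ × ℝ × ℝ => τ.2.2 := by fun_prop
  have hprod := (((hdensity.mul hphase).mul (hΓ₀ hu)).mul (hΓ₀ hv)).mul
    (continuous_finsetProd Finset.univ fun i _ => (hΓ (hγ i) hu).mul (hΓ (hγ i) hv))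
  exact hprod.congr fun τ => (mellinBarnesIntegrand_eq γ x τ.1 τ.2.1 τ.2.2).symm

theorem mellinBarnesIntegrand_isBigO_exp (hγ : ∀ i, (γ i).im < 1 / 2) (x : Fin 3 → ℝ) :
    mellinBarnesIntegrand γ x =O[⊤] fun (t, u, v) =>
      rexp (-(1 / 2) * |t|) * (rexp (-(1 / 2) * |u|) * rexp (-(1 / 2) * |v|)) := by
  have hdensity : (fun τ : ℝ × ℝ × ℝ => wilsonDensity ((τ.2.1 - τ.2.2) / 2 : ℝ)) =O[⊤]
      fun τ => rexp (7 * |(τ.2.1 - τ.2.2) / 2|) :=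
    (wilsonDensity_ofReal_isBigO_exp (by linarith [Real.pi_lt_d2])).comp_tendsto tendsto_top
  have hphase : (fun τ : ℝ × ℝ × ℝ => cexp ((((x 1 - x 2) * (τ.2.1 + τ.2.2)
      + (x 0 - x 1) * τ.1 : ℝ) : ℂ) * I)) =O[⊤] fun _ => (1 : ℝ) :=
    .of_bound' (.of_forall fun τ => by rw [Complex.norm_exp_ofReal_mul_I, norm_one])
  have hΓ₀ (p : ℝ × ℝ × ℝ → ℝ) : (fun τ => Gamma (I * (p τ - τ.1) + 1 / 2)) =O[⊤]
      fun τ => rexp (-(3 / 2) * |τ.1 - p τ|) := by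
    simpa using Gamma_I_mul_sub_add_half_isBigO_exp (g := 0) (by simp) fun τ => τ.1 - p τ
  have hΓ (i : Fin 3) (p : ℝ × ℝ × ℝ → ℝ) := Gamma_I_mul_sub_add_half_isBigO_exp (hγ i) p
  have hprod := (((hdensity.mul hphase).mul (hΓ₀ (·.2.1))).mul (hΓ₀ (·.2.2))).mul
    (IsBigO.finsetProd (s := Finset.univ) fun i _ => (hΓ i (·.2.1)).mul (hΓ i (·.2.2)))
  refine (hprod.congr_left fun τ => (mellinBarnesIntegrand_eq γ x _ _ _).symm).trans
    (.of_bound' (.of_forall fun ⟨t, u, v⟩ => ?_))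
  have huv : |u - v| ≤ |u| + |v| := abs_sub u v
  have htu : |t| ≤ |t - u| + |u| := by simpa using abs_add_le (t - u) u
  have htv : 0 ≤ |t - v| := abs_nonneg _
  simp only [Fin.prod_univ_three, mul_one, ← Real.exp_add, Real.norm_eq_abs, Real.abs_exp,
    Real.exp_le_exp, abs_div, Nat.abs_ofNat]
  linarith [abs_nonneg (t - u), abs_nonneg u, abs_nonneg v]

theorem integrable_mellinBarnesIntegrand (hγ : ∀ i, (γ i).im < 1 / 2) (x : Fin 3 → ℝ) :
    Integrable (mellinBarnesIntegrand γ x) := by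
  have hexp : Integrable fun t : ℝ => rexp (-(1 / 2) * |t|) :=
    integrable_exp_neg_mul_abs (by norm_num)
  exact (mellinBarnesIntegrand_isBigO_exp hγ x).integrable
    (continuous_mellinBarnesIntegrand hγ x).aestronglyMeasurable
    (hexp.mul_prod (hexp.mul_prod hexp))

/-! ### Reduction of the Mellin–Barnes integral to Bump's integral -/

theorem measurePreserving_half_add_half_sub :
    MeasurePreserving fun p : ℝ × ℝ => (p.1 / 2 + p.2, p.1 / 2 - p.2) := by
  have hshear : MeasurePreserving fun p : ℝ × ℝ => (p.1, p.2 + p.1 / 2) :=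
    (MeasurePreserving.id volume).skew_product (g := fun σ t => t + σ / 2) (by fun_prop)
      (.of_forall fun σ => (measurePreserving_add_right volume (σ / 2)).map_eq)
  have hcomp : (fun p : ℝ × ℝ => (p.1 / 2 + p.2, p.1 / 2 - p.2))
      = (fun z : ℝ × ℝ => (z.1, z.2 - z.1)) ∘ Prod.swap ∘ fun p => (p.1, p.2 + p.1 / 2) := by
    refine funext fun p => Prod.ext (add_comm _ _) ?_
    simp only [Function.comp_apply, Prod.swap_prod_mk]
    ring
  rw [hcomp]
  exact (measurePreserving_prod_sub volume volume).comp
    (Measure.measurePreserving_swap.comp hshear)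

theorem integral_eq_integral_half_add_half_sub {X E : Type*} [MeasurableSpace X] {μ : Measure X}
    [SFinite μ] [NormedAddCommGroup E] [NormedSpace ℝ E] {f : X × ℝ × ℝ → E}
    (hf : Integrable f (μ.prod volume)) :
    ∫ p, f p ∂μ.prod volume
      = ∫ w : X × ℝ, ∫ t : ℝ, f (w.1, w.2 / 2 + t, w.2 / 2 - t) ∂volume ∂μ.prod volume := by
  have hmp : MeasurePreserving
      (fun q : (X × ℝ) × ℝ => (q.1.1, q.1.2 / 2 + q.2, q.1.2 / 2 - q.2))
      ((μ.prod volume).prod volume) (μ.prod volume) :=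
    ((MeasurePreserving.id μ).prod measurePreserving_half_add_half_sub).comp
      (measurePreserving_prodAssoc μ volume volume)
  have hfmap := hf
  rw [← hmp.map_eq] at hfmap
  have hmap := integral_map hmp.aemeasurable hfmap.aestronglyMeasurable
  rw [hmp.map_eq] at hmap
  exact hmap.trans (integral_prod _ (hmp.integrable_comp_of_integrable hf))

theorem integral_mellinBarnesIntegrand_fiber_eq_wilsonIntegral (γ : Fin 3 → ℂ) (x : Fin 3 → ℝ)
    (w₁ w₂ : ℝ) :
    ∫ t : ℝ, mellinBarnesIntegrand γ x (w₁, w₂ / 2 + t, w₂ / 2 - t)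
      = cexp (I * (x 1 - x 2) * w₂ + I * (x 0 - x 1) * w₁)
        * wilsonIntegral (I * (w₂ / 2 - w₁) + 1 / 2) (I * (γ 0 - w₂ / 2) + 1 / 2)
          (I * (γ 1 - w₂ / 2) + 1 / 2) (I * (γ 2 - w₂ / 2) + 1 / 2) := by
  rw [wilsonIntegral, ← integral_const_mul]
  refine integral_congr_ae (.of_forall fun t => ?_)
  simp only [mellinBarnesIntegrand_eq, continuousDualHahnWeight, gammaPair, Fin.prod_univ_three]
  push_cast
  ring_nf

theorem integral_mellinBarnesIntegrand_fiber (hγ : ∀ i, (γ i).im < 1 / 2) (x : Fin 3 → ℝ)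
    (w₁ w₂ : ℝ) :
    cexp (I * (γ 0 + γ 1 + γ 2) * x 2 - (x 0 - x 2))
        * ∫ t : ℝ, mellinBarnesIntegrand γ x (w₁, w₂ / 2 + t, w₂ / 2 - t)
      = 4 * π * bumpKernel γ x (1 - I * w₁) (1 - I * w₂) := by
  have hre (i : Fin 3) : 0 < (I * (γ i - w₂ / 2) + 1 / 2).re := by
    simp
    linarith [hγ i]
  rw [integral_mellinBarnesIntegrand_fiber_eq_wilsonIntegral,
    wilsonIntegral_eq (by simp) (hre 0) (hre 1) (hre 2), ← mul_assoc, ← Complex.exp_add,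
    bumpKernel, Fin.prod_univ_three, Fin.sum_univ_three]
  ring_nf

theorem mellinBarnesIntegral_eq_integral_bumpKernel (hγ : ∀ i, (γ i).im < 1 / 2)
    (x : Fin 3 → ℝ) :
    (2 * π) ^ 2 * mellinBarnesIntegral γ x
      = ∫ w : ℝ × ℝ, bumpKernel γ x (1 - I * w.1) (1 - I * w.2) := by
  have hpi : (π : ℂ) ≠ 0 := by exact_mod_cast Real.pi_ne_zero
  have hfiber : cexp (I * (γ 0 + γ 1 + γ 2) * x 2 - (x 0 - x 2))
        * ∫ τ, mellinBarnesIntegrand γ x τ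
      = 4 * π * ∫ w : ℝ × ℝ, bumpKernel γ x (1 - I * w.1) (1 - I * w.2) := by
    rw [Measure.volume_eq_prod,
      integral_eq_integral_half_add_half_sub (integrable_mellinBarnesIntegrand hγ x),
      ← integral_const_mul, ← integral_const_mul]
    simp only [integral_mellinBarnesIntegrand_fiber hγ]
    rfl
  rw [mellinBarnesIntegral, div_mul_eq_mul_div, hfiber]
  field_simp
  norm_num

end MellinBarnes

theorem mainTheorem2 (γ : Fin 3 → ℂ) (hγ : ∀ i, (γ i).im < 1 / 2) (x : Fin 3 → ℝ) :
    MeasureTheory.Integrable (giventalIntegrand γ x) ∧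
    MeasureTheory.Integrable (mellinBarnesIntegrand γ x) ∧
    giventalIntegral γ x = mellinBarnesIntegral γ x := by
  refine ⟨integrable_giventalIntegrand γ x, integrable_mellinBarnesIntegrand hγ x, ?_⟩
  have hpi : (2 * π : ℂ) ^ 2 ≠ 0 := by simp [Real.pi_ne_zero]
  have hpair (i : Fin 3) : (∑ j, γ j - γ i).im < 1 := by
    fin_cases i <;> simp [Fin.sum_univ_three] <;> linarith [hγ 0, hγ 1, hγ 2]
  refine mul_left_cancel₀ hpi ?_
  have hgivental := giventalIntegral_eq_integral_bumpKernel (c₁ := 1) (c₂ := 1)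
    (fun i => (hγ i).trans (by norm_num)) hpair x
  rw [mellinBarnesIntegral_eq_integral_bumpKernel hγ]
  exact_mod_cast hgivental
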